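/- **Theorem (Differential Equations).** Let $U\in M_N(\mathbb{C})$ be unitary with simple spectrum, with eigenvalues $e^{i\theta_1},\dots,e^{i\theta_N}$, $\theta_j\in[0,2\pi)$, and associated unit eigenvectors $u_1,\dots,u_N$. For a unit vector $v\in\mathbb{C}^N$ put $G(t)=U\bigl(I_N-(1-t)vv^*\bigr)$. An *eigenvalue flow* is a family of continuous functions $\lambda_1,\dots,\lambda_N:(0,1]\to\mathbb{C}$ such that, for every $t\in(0,1]$, $\lambda_1(t),\dots,\lambda_N(t)$ are the eigenvalues of $G(t)$ counted with algebraic multiplicity, and $\lambda_j(1)=e^{i\theta_j}$ for all $j$. (a) Let $v$ be any unit vector and $(\lambda_j)$ any eigenvalue flow. For every $t\in(0,1)$ at which $\lambda_1(t),\dots,\lambda_N(t)$ are pairwise distinct, each $\lambda_j$ is differentiable at $t$ and $$\lambda_j'(t)=\frac{1-|\lambda_j(t)|^2}{t(1-t^2)}\Bigl(\prod_{k=1}^N\lambda_k(t)\Bigr)\prod_{k\neq j}\frac{\lambda_j(t)\overline{\lambda_k(t)}-1}{\lambda_j(t)-\lambda_k(t)},\qquad j=1,\dots,N. \tag{$*$}$$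 The initial conditions are $\lambda_j(1)=e^{i\theta_j}$ and $\lambda_j'(1)=e^{i\theta_j}|\langle u_j,v\rangle|^2$ (left derivative). Moreover the right-hand side of $(*)$, which has the form $0/0$ at $t=1$, tends to $e^{i\theta_j}|\langle u_j,v\rangle|^2$ as $t\to1^-$, so that $(*)$ holds at $t=1$ in this sense. (b) Let now $U$ be a random unitary matrix whose spectrum is almost surely simple, and let $v$ be a random unit vector, independent of $U$, whose law is absolutely continuous with respect to the surface measure of the unit sphere of $\mathbb{C}^N$. Then almost surely the following holds: for every choice of $\theta_j$ and $u_j$ as above there is exactly one eigenvalue flow, $\lambda_1(t),\dots,\lambda_N(t)$ are pairwise distinct for every $t\in(0,1)$, and the flow satisfies $(*)$ for every $t\in(0,1)$ together with the initial conditions at $t=1$ as in (a). -/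

import Mathlib

open MeasureTheory ProbabilityTheory Set Filter Topology Polynomial

/-- `M` has simple spectrum: its `N` complex eigenvalues, counted with algebraic multiplicity,
are pairwise distinct. -/
def HasSimpleSpectrum {N : ℕ} (M : Matrix (Fin N) (Fin N) ℂ) : Prop :=
  M.charpoly.roots.Nodup

/-- The rank one multiplicative perturbation `G(t) = U (I - (1 - t) v v^*)`. -/
noncomputable def perturbed {N : ℕ} (U : Matrix (Fin N) (Fin N) ℂ)
    (v : EuclideanSpace ℂ (Fin N)) (t : ℝ) : Matrix (Fin N) (Fin N) ℂ :=
  U * (1 - (1 - (t : ℂ)) • Matrix.vecMulVec (WithLp.ofLp v) (star (WithLp.ofLp v)))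

/-- `exp (i θ_j)` are the eigenvalues of `U` (with multiplicity), with `θ_j ∈ [0, 2π)`, and `u_j`
is a unit eigenvector for `exp (i θ_j)`. -/
structure IsEigenData {N : ℕ} (U : Matrix (Fin N) (Fin N) ℂ) (θ : Fin N → ℝ)
    (u : Fin N → EuclideanSpace ℂ (Fin N)) : Prop where
  angle_mem : ∀ j, θ j ∈ Ico 0 (2 * Real.pi)
  charpoly_eq : U.charpoly = ∏ j, (X - C (Complex.exp (Complex.I * θ j)))
  norm_eq_one : ∀ j, ‖u j‖ = 1
  eigenvector : ∀ j, Matrix.toEuclideanLin U (u j) = Complex.exp (Complex.I * θ j) • u j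

/-- `lam 1, …, lam N` is a labelling of the eigenvalues of `G(t)`, `t ∈ (0,1]` (with algebraic
multiplicity), by continuous trajectories, the `j`-th of which is at `exp (i θ_j)` at time `1`. -/
structure IsEigenvalueFlow {N : ℕ} (U : Matrix (Fin N) (Fin N) ℂ) (v : EuclideanSpace ℂ (Fin N))
    (θ : Fin N → ℝ) (lam : Fin N → ℝ → ℂ) : Prop where
  continuousOn : ∀ j, ContinuousOn (lam j) (Ioc 0 1)
  charpoly_eq : ∀ t ∈ Ioc (0 : ℝ) 1, (perturbed U v t).charpoly = ∏ j, (X - C (lam j t))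
  init : ∀ j, lam j 1 = Complex.exp (Complex.I * θ j)

/-- The right-hand side of the differential equations, at time `t` and configuration `z`:
`(1 - |z_j|²) / (t (1 - t²)) * ∏_k z_k * ∏_{k ≠ j} (z_j conj(z_k) - 1) / (z_j - z_k)`. -/
noncomputable def velocity {N : ℕ} (t : ℝ) (z : Fin N → ℂ) (j : Fin N) : ℂ :=
  (1 - (‖z j‖ : ℂ) ^ 2) / ((t : ℂ) * (1 - (t : ℂ) ^ 2)) * (∏ k, z k) *
    ∏ k ∈ Finset.univ.erase j, (z j * (starRingEnd ℂ) (z k) - 1) / (z j - z k)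

/-- The derivative of the `j`-th trajectory at time `1`: `exp (i θ_j) |⟨u_j, v⟩|²`. -/
noncomputable def initialVelocity {N : ℕ} (v : EuclideanSpace ℂ (Fin N)) (θ : Fin N → ℝ)
    (u : Fin N → EuclideanSpace ℂ (Fin N)) (j : Fin N) : ℂ :=
  Complex.exp (Complex.I * θ j) * (‖inner ℂ (u j) v‖ : ℂ) ^ 2

/-- Behaviour at time `1`: the (left) derivative has the prescribed value, and the right-hand side
of the differential equations, which has the form `0 / 0` at `t = 1`, extends continuously to
`t = 1` by this value. -/
def HasInitialVelocity {N : ℕ} (v : EuclideanSpace ℂ (Fin N)) (θ : Fin N → ℝ)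
    (u : Fin N → EuclideanSpace ℂ (Fin N)) (lam : Fin N → ℝ → ℂ) : Prop :=
  ∀ j, HasDerivWithinAt (lam j) (initialVelocity v θ u j) (Iic 1) 1 ∧
    Tendsto (fun t : ℝ => velocity t (fun k => lam k t) j) (𝓝[<] 1)
      (𝓝 (initialVelocity v θ u j))

/-- The uniform (surface) measure on the unit sphere of `ℂ^N`, up to normalization. -/
noncomputable def sphereMeasure (N : ℕ) :
    Measure (Metric.sphere (0 : EuclideanSpace ℂ (Fin N)) 1) :=
  (volume : Measure (EuclideanSpace ℂ (Fin N))).toSphere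

/-- The Borel σ-algebra on complex matrices. -/
noncomputable instance matrixMeasurableSpace (N : ℕ) : MeasurableSpace (Matrix (Fin N) (Fin N) ℂ) :=
  borel _

/-! Let `μ k` be the eigenvalues of `U` and `w k` the squared moduli of the coordinates of `v` in
its eigenbasis, so that `∑ k, w k = 1`. By the matrix determinant lemma the characteristic
polynomial of `G(t)` is `P + (1 - t) W`, with `P = nodePoly μ` and `W = weightPoly μ w`: it is
affine in `t`. Hence a continuous simple root `λ_j` has derivative `W(λ_j) / ∏_{k ≠ j} (λ_j - λ_k)`
(`hasDerivWithinAt_root_of_pencil`). This form is regular at `t = 1` and yields the initial velocity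
there. For `t < 1` it equals the stated right-hand side: conjugating the identity `∏ (X - λ_k) = P +
(1 - t) W` at the reflected point `1 / conj λ_j` gives a second relation between `P(λ_j)` and
`W(λ_j)`, which determines `W(λ_j)` from the eigenvalues alone (`eval_weightPoly_root`).

If every `G(t)` has simple spectrum, the pairs (time, root) form a finite covering of `(0, 1]`; path
lifting gives existence, uniqueness and absence of collisions (`exists_unique_flow`).

It remains to exclude collisions almost surely. By independence and Fubini, `U` may be fixed;
passing to the cone over the sphere replaces `v` by Lebesgue almost every `y`. Off the nodes, a
double root is a critical point of `f(z) = ∑ w k μ k / (z - μ k)` with the real critical value `-1 /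
s`. When only `w j` varies, criticality expresses both `w j` and `f` as holomorphic functions `A`,
`B` of `z`, and both must be real. Since `A' = ((z - μ j) / μ j) B'`, these are two independent real
conditions off the line through `μ j`, so only countably many `w j` are bad
(`countable_critical_weights`). A point on the lines through all the `μ j` is possible only for `N ≤
2`, where `s ‖y‖² < 1` rules it out (`exists_im_ne_zero_of_critical`). -/

/-! ### The secular polynomial of a rank one perturbation -/

/-- The polynomial with roots `μ k`. -/
noncomputable def nodePoly {N : ℕ} (μ : Fin N → ℂ) : ℂ[X] := ∏ k, (X - C (μ k))

/-- `∑ k, w k * μ k * ∏ l ≠ k, (X - μ l)`. -/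
noncomputable def weightPoly {N : ℕ} (μ : Fin N → ℂ) (w : Fin N → ℝ) : ℂ[X] :=
  ∑ k, C ((w k : ℂ) * μ k) * ∏ l ∈ Finset.univ.erase k, (X - C (μ l))

section Poly

variable {N : ℕ} {μ : Fin N → ℂ} {w : Fin N → ℝ}

lemma eval_nodePoly (μ : Fin N → ℂ) (z : ℂ) : (nodePoly μ).eval z = ∏ k, (z - μ k) := by
  simp [nodePoly, eval_prod]

lemma eval_weightPoly (μ : Fin N → ℂ) (w : Fin N → ℝ) (z : ℂ) :
    (weightPoly μ w).eval z = ∑ k, (w k : ℂ) * μ k * ∏ l ∈ Finset.univ.erase k, (z - μ l) := by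
  simp [weightPoly, eval_finsetSum, eval_prod]

lemma prod_erase_eq_div {f : Fin N → ℂ} (k : Fin N) (hf : f k ≠ 0) :
    ∏ l ∈ Finset.univ.erase k, f l = (∏ l, f l) / f k := by
  rw [← Finset.mul_prod_erase Finset.univ f (Finset.mem_univ k), mul_div_cancel_left₀ _ hf]

lemma eval_weightPoly_of_ne (w : Fin N → ℝ) {z : ℂ} (hz : ∀ k, z ≠ μ k) :
    (weightPoly μ w).eval z = (nodePoly μ).eval z * ∑ k, (w k : ℂ) * μ k / (z - μ k) := by
  rw [eval_weightPoly, eval_nodePoly, Finset.mul_sum]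
  refine Finset.sum_congr rfl fun k _ => ?_
  rw [prod_erase_eq_div k (sub_ne_zero.2 (hz k))]
  ring

lemma eval_weightPoly_node (w : Fin N → ℝ) (j : Fin N) :
    (weightPoly μ w).eval (μ j)
      = (w j : ℂ) * μ j * ∏ l ∈ Finset.univ.erase j, (μ j - μ l) := by
  rw [eval_weightPoly]
  refine Finset.sum_eq_single j (fun k _ hk => ?_) (by simp)
  rw [Finset.prod_eq_zero (Finset.mem_erase.2 ⟨hk.symm, Finset.mem_univ j⟩) (sub_self _), mul_zero]

lemma conj_mul_self_of_norm_eq_one {z : ℂ} (hz : ‖z‖ = 1) : (starRingEnd ℂ) z * z = 1 := by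
  rw [mul_comm, Complex.mul_conj, Complex.normSq_eq_norm_sq, hz]; simp

/-- The roots of `nodePoly μ + (1 - t) weightPoly μ w` have product `t ∏ μ k`. -/
lemma prod_roots_eq {t : ℝ} {z : Fin N → ℂ} (hw : ∑ k, w k = 1)
    (hz : nodePoly z = nodePoly μ + C (1 - (t : ℂ)) * weightPoly μ w) :
    ∏ k, z k = t * ∏ k, μ k := by
  have hw' : ∑ k, (w k : ℂ) = 1 := by exact_mod_cast hw
  have h := congrArg (eval 0) hz
  rw [eval_add, eval_mul, eval_C, eval_nodePoly, eval_nodePoly, eval_weightPoly] at h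
  -- Since the weights sum to one, `W(0) = -P(0)`, so the constant term of the pencil is `t P(0)`.
  have h2 : ∑ k, (w k : ℂ) * μ k * ∏ l ∈ Finset.univ.erase k, (0 - μ l) = -∏ k, (0 - μ k) := by
    rw [← one_mul (∏ k, (0 - μ k)), ← hw', Finset.sum_mul, ← Finset.sum_neg_distrib]
    refine Finset.sum_congr rfl fun k _ => ?_
    rw [← Finset.mul_prod_erase Finset.univ (fun l => 0 - μ l) (Finset.mem_univ k)]
    ring
  have h3 : ∏ k, (0 - z k) = t * ∏ k, (0 - μ k) := by rw [h, h2]; ring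
  simp only [zero_sub, Finset.prod_neg] at h3
  have h4 : ((-1 : ℂ) ^ (Finset.univ : Finset (Fin N)).card) ≠ 0 := by simp
  apply mul_left_cancel₀ h4
  rw [h3]; ring

/-- The value of `weightPoly` at a root, as dictated by reflection in the unit circle. -/
lemma eval_weightPoly_root {t : ℝ} {z : Fin N → ℂ} (hw : ∑ k, w k = 1) (hμ : ∀ k, ‖μ k‖ = 1)
    (ht : 0 < t) (hz : nodePoly z = nodePoly μ + C (1 - (t : ℂ)) * weightPoly μ w) (j : Fin N) :
    (weightPoly μ w).eval (z j) * (t * (1 - (t : ℂ) ^ 2))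
      = -(∏ k, z k) * ∏ k, (z j * (starRingEnd ℂ) (z k) - 1) := by
  have hw' : ∑ k, (w k : ℂ) = 1 := by exact_mod_cast hw
  have hprod := prod_roots_eq hw hz
  have ht0 : (t : ℂ) ≠ 0 := by exact_mod_cast ht.ne'
  have hμ0 : ∀ k, μ k ≠ 0 := fun k => norm_ne_zero_iff.1 (by rw [hμ]; norm_num)
  have hz0 : z j ≠ 0 := fun h => by
    have : ∏ k, z k = 0 := Finset.prod_eq_zero (Finset.mem_univ j) h
    rw [hprod] at this
    exact mul_ne_zero ht0 (Finset.prod_ne_zero_iff.2 fun k _ => hμ0 k) this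
  set a := z j with ha
  -- The reflection of `a` in the unit circle. Multiplying a conjugated value at `y` by `(-a)^N`
  -- turns each factor `y - c` into `a * conj c - 1`, which for unimodular `c` is `conj c * (a -
  -- c)`.
  set y : ℂ := (starRingEnd ℂ a)⁻¹ with hy
  have hya : a * (starRingEnd ℂ) y = 1 := by
    simp [hy, hz0]
  have key : ∀ c : ℂ, -a * (starRingEnd ℂ) (y - c) = a * (starRingEnd ℂ) c - 1 := fun c => by
    rw [map_sub]; linear_combination -hya
  have hμa : ∀ k, a * (starRingEnd ℂ) (μ k) - 1 = (starRingEnd ℂ) (μ k) * (a - μ k) := fun k => by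
    linear_combination conj_mul_self_of_norm_eq_one (hμ k)
  have hroot : (nodePoly μ).eval a = -(1 - t) * (weightPoly μ w).eval a := by
    have h := congrArg (eval a) hz
    rw [eval_add, eval_mul, eval_C, eval_nodePoly z,
      Finset.prod_eq_zero (Finset.mem_univ j) (by rw [ha, sub_self])] at h
    linear_combination -h
  have h1 : ∑ k, (w k : ℂ) * (a * ∏ l ∈ Finset.univ.erase k, (a - μ l))
      = (nodePoly μ).eval a + (weightPoly μ w).eval a := by
    rw [eval_nodePoly, eval_weightPoly, ← one_mul (∏ k, (a - μ k)), ← hw', Finset.sum_mul,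
      ← Finset.sum_add_distrib]
    refine Finset.sum_congr rfl fun k _ => ?_
    rw [← Finset.mul_prod_erase Finset.univ (fun l => a - μ l) (Finset.mem_univ k)]
    ring
  set M := ∏ k, (starRingEnd ℂ) (μ k) with hM
  have h2 : ∏ k, (a * (starRingEnd ℂ) (z k) - 1)
      = M * ((nodePoly μ).eval a - (1 - t) * ((nodePoly μ).eval a + (weightPoly μ w).eval a)) := by
    have h := congrArg (fun P : ℂ[X] => ((∏ _k : Fin N, -a) * (starRingEnd ℂ) (P.eval y))) hz
    simp only [eval_add, eval_mul, eval_C, eval_nodePoly, eval_weightPoly, map_add, map_mul,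
      map_prod, map_sum, mul_add] at h
    rw [← Finset.prod_mul_distrib, ← Finset.prod_mul_distrib] at h
    simp only [key, hμa] at h
    rw [h, ← h1, Finset.prod_mul_distrib, eval_nodePoly, mul_sub]
    rw [sub_eq_add_neg (M * _)]
    congr 1
    simp only [Finset.mul_sum]
    rw [← Finset.sum_neg_distrib]
    refine Finset.sum_congr rfl fun k _ => ?_
    rw [← Finset.mul_prod_erase Finset.univ (fun _ => -a) (Finset.mem_univ k)]
    have h5 : (∏ _l ∈ Finset.univ.erase k, -a) *
        ∏ l ∈ Finset.univ.erase k, (starRingEnd ℂ) (y - μ l)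
        = ∏ l ∈ Finset.univ.erase k, ((starRingEnd ℂ) (μ l) * (a - μ l)) := by
      rw [← Finset.prod_mul_distrib]
      exact Finset.prod_congr rfl fun l _ => by rw [key, hμa]
    rw [Finset.prod_mul_distrib] at h5
    rw [hM, ← Finset.mul_prod_erase Finset.univ (fun l => (starRingEnd ℂ) (μ l))
      (Finset.mem_univ k)]
    simp only [map_sub, map_one, Complex.conj_ofReal] at h5 ⊢
    linear_combination (-a * (1 - (t : ℂ)) * w k * (starRingEnd ℂ) (μ k)) * h5
  have hMμ : (∏ k, μ k) * M = 1 := by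
    rw [hM, ← Finset.prod_mul_distrib]
    exact Finset.prod_eq_one fun k _ => by rw [mul_comm]; exact conj_mul_self_of_norm_eq_one (hμ k)
  -- With `P(a) = -(1 - t) W(a)`, the bracket `P - (1 - t)(P + W)` in `h2` collapses to `-(1 - t²)
  -- W(a)`.
  rw [h2, hprod, hroot]
  linear_combination (-(weightPoly μ w).eval a * t * (1 - t ^ 2)) * hMμ

/-- The factor `k = j` of the product in `eval_weightPoly_root` is `|z_j|² - 1`, which supplies the
numerator of `velocity`. The right-hand side has no singularity at `t = 1`. -/
lemma velocity_eq {t : ℝ} {z : Fin N → ℂ} (hw : ∑ k, w k = 1) (hμ : ∀ k, ‖μ k‖ = 1)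
    (ht : t ∈ Ioo (0 : ℝ) 1)
    (hz : nodePoly z = nodePoly μ + C (1 - (t : ℂ)) * weightPoly μ w) (j : Fin N) :
    velocity t z j = (weightPoly μ w).eval (z j) / ∏ k ∈ Finset.univ.erase j, (z j - z k) := by
  have h := eval_weightPoly_root hw hμ ht.1 hz j
  have ht0 : (t : ℂ) * (1 - (t : ℂ) ^ 2) ≠ 0 := by
    have : t * (1 - t ^ 2) ≠ 0 := by
      have := ht.1; have := ht.2; have : 0 < 1 - t ^ 2 := by nlinarith
      positivity
    exact_mod_cast this
  rw [← Finset.mul_prod_erase Finset.univ (fun k => z j * (starRingEnd ℂ) (z k) - 1)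
      (Finset.mem_univ j), Complex.mul_conj, Complex.normSq_eq_norm_sq] at h
  rw [velocity, Finset.prod_div_distrib, ← mul_div_assoc]
  congr 1
  rw [div_mul_eq_mul_div, div_mul_eq_mul_div, div_eq_iff ht0, h]
  push_cast
  ring

end Poly

/-! ### Eigenbases of unitary matrices with simple spectrum -/

/-- `u` is an orthonormal basis of eigenvectors of `U`, for the distinct unimodular eigenvalues
`μ`. -/
structure IsUnimodularEigenbasis {N : ℕ} (U : Matrix (Fin N) (Fin N) ℂ) (μ : Fin N → ℂ)
    (u : OrthonormalBasis (Fin N) ℂ (EuclideanSpace ℂ (Fin N))) : Prop where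
  charpoly_eq : U.charpoly = nodePoly μ
  norm_eq_one : ∀ k, ‖μ k‖ = 1
  injective : Function.Injective μ
  eigenvector : ∀ k, Matrix.toEuclideanLin U (u k) = μ k • u k

section Eigenbasis

variable {N : ℕ} {U : Matrix (Fin N) (Fin N) ℂ} {μ : Fin N → ℂ}

lemma roots_nodePoly (μ : Fin N → ℂ) : (nodePoly μ).roots = Finset.univ.val.map μ := by
  rw [← roots_multiset_prod_X_sub_C (Finset.univ.val.map μ), Multiset.map_map]
  rfl

lemma nodup_roots_nodePoly : (nodePoly μ).roots.Nodup ↔ Function.Injective μ := by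
  rw [roots_nodePoly]
  exact ⟨fun h j k hjk => Multiset.inj_on_of_nodup_map h j (Finset.mem_univ_val j) k
    (Finset.mem_univ_val k) hjk, fun h => Finset.univ.nodup.map h⟩

lemma inner_toEuclideanLin_of_mem_unitaryGroup (hU : U ∈ Matrix.unitaryGroup (Fin N) ℂ)
    (x y : EuclideanSpace ℂ (Fin N)) :
    inner ℂ (Matrix.toEuclideanLin U x) (Matrix.toEuclideanLin U y) = inner ℂ x y := by
  rw [← LinearMap.adjoint_inner_right, ← Matrix.toEuclideanLin_conjTranspose_eq_adjoint]
  congr 1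
  have h : U.conjTranspose * U = 1 := Matrix.mem_unitaryGroup_iff'.1 hU
  ext i
  simp [Matrix.toLpLin_apply, Matrix.mulVec_mulVec, h]

/-- Unitarity gives `conj (μ j) * μ k * ⟨u j, u k⟩ = ⟨u j, u k⟩`: the case `j = k` makes the
eigenvalues unimodular, and distinctness then forces orthogonality. -/
lemma exists_orthonormalBasis_of_eigenvectors (hU : U ∈ Matrix.unitaryGroup (Fin N) ℂ)
    (hp : U.charpoly = nodePoly μ) (hinj : Function.Injective μ)
    {u : Fin N → EuclideanSpace ℂ (Fin N)} (hu : ∀ k, ‖u k‖ = 1)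
    (he : ∀ k, Matrix.toEuclideanLin U (u k) = μ k • u k) :
    ∃ b : OrthonormalBasis (Fin N) ℂ (EuclideanSpace ℂ (Fin N)),
      IsUnimodularEigenbasis U μ b ∧ ∀ k, b k = u k := by
  have hinner : ∀ j k, (starRingEnd ℂ) (μ j) * μ k * inner ℂ (u j) (u k) = inner ℂ (u j) (u k) := by
    intro j k
    have h := inner_toEuclideanLin_of_mem_unitaryGroup hU (u j) (u k)
    rw [he, he, inner_smul_left, inner_smul_right] at h
    rw [mul_assoc]; exact h
  have hμ : ∀ k, ‖μ k‖ = 1 := by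
    intro k
    have h := hinner k k
    rw [inner_self_eq_norm_sq_to_K, hu, mul_comm ((starRingEnd ℂ) (μ k)), Complex.mul_conj,
      Complex.normSq_eq_norm_sq] at h
    have h2 : ‖μ k‖ ^ 2 = 1 := by
      simp only [RCLike.ofReal_one, one_pow, mul_one] at h
      exact_mod_cast h
    exact (pow_eq_one_iff_of_nonneg (norm_nonneg _) two_ne_zero).1 h2
  have hon : Orthonormal ℂ u := by
    refine ⟨hu, fun j k hjk => ?_⟩
    by_contra h0
    have h1 : (starRingEnd ℂ) (μ j) * μ k = 1 := by
      have := hinner j k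
      exact mul_right_cancel₀ h0 (by rw [this, one_mul])
    apply hjk
    apply hinj
    have h2 := conj_mul_self_of_norm_eq_one (hμ j)
    have h3 : (starRingEnd ℂ) (μ j) ≠ 0 := fun h => by simp [h] at h1
    exact mul_left_cancel₀ h3 (h2.trans h1.symm)
  have hspan : ⊤ ≤ Submodule.span ℂ (range u) := by
    rw [hon.linearIndependent.span_eq_top_of_card_eq_finrank' (by simp)]
  refine ⟨OrthonormalBasis.mk hon hspan, ⟨hp, hμ, hinj, fun k => ?_⟩, fun k => by simp⟩
  simp [he]

lemma HasSimpleSpectrum.exists_charpoly_eq (hs : HasSimpleSpectrum U) :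
    ∃ μ : Fin N → ℂ, Function.Injective μ ∧ U.charpoly = nodePoly μ := by
  have hsplit : U.charpoly.Splits := IsAlgClosed.splits _
  have hcard : U.charpoly.roots.toFinset.card = N := by
    rw [Multiset.toFinset_card_of_nodup hs, ← hsplit.natDegree_eq_card_roots,
      Matrix.charpoly_natDegree_eq_dim, Fintype.card_fin]
  obtain ⟨e⟩ : Nonempty (Fin N ≃ U.charpoly.roots.toFinset) :=
    ⟨(Finset.equivFinOfCardEq hcard).symm⟩
  let μ : Fin N → ℂ := fun k => e k
  have hinj : Function.Injective μ := Subtype.val_injective.comp e.injective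
  refine ⟨μ, hinj, ?_⟩
  rw [hsplit.eq_prod_roots_of_monic (Matrix.charpoly_monic U), nodePoly]
  have h1 : (U.charpoly.roots.map fun a => X - C a).prod
      = ∏ a ∈ U.charpoly.roots.toFinset, (X - C a) := by
    rw [Finset.prod, Multiset.toFinset_val, hs.dedup]
  rw [h1, ← Finset.prod_coe_sort]
  exact (e.prod_comp (fun a => X - C (a : ℂ))).symm

lemma exists_unimodularEigenbasis (hU : U ∈ Matrix.unitaryGroup (Fin N) ℂ)
    (hs : HasSimpleSpectrum U) :
    ∃ (μ : Fin N → ℂ) (b : OrthonormalBasis (Fin N) ℂ (EuclideanSpace ℂ (Fin N))),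
      IsUnimodularEigenbasis U μ b := by
  obtain ⟨μ, hinj, hp⟩ := hs.exists_charpoly_eq
  have hev : ∀ k, ∃ x : EuclideanSpace ℂ (Fin N), ‖x‖ = 1 ∧
      Matrix.toEuclideanLin U x = μ k • x := by
    intro k
    have hk : IsRoot U.charpoly (μ k) := by
      rw [hp, IsRoot.def, eval_nodePoly]
      exact Finset.prod_eq_zero (Finset.mem_univ k) (sub_self _)
    have hk' : (Matrix.scalar (Fin N) (μ k) - U).det = 0 := by
      rw [← Matrix.eval_charpoly]; exact hk
    obtain ⟨x, hx0, hx⟩ := Matrix.exists_mulVec_eq_zero_iff.2 hk'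
    have hx' : U.mulVec x = μ k • x := by
      rw [Matrix.sub_mulVec, sub_eq_zero] at hx
      rw [← hx, Matrix.scalar_apply, ← Matrix.smul_one_eq_diagonal, Matrix.smul_mulVec,
        Matrix.one_mulVec]
    have hy0 : (WithLp.toLp 2 x : EuclideanSpace ℂ (Fin N)) ≠ 0 := fun h => hx0 (by
      simpa using congrArg WithLp.ofLp h)
    refine ⟨((‖(WithLp.toLp 2 x : EuclideanSpace ℂ (Fin N))‖ : ℂ)⁻¹) • WithLp.toLp 2 x,
      by rw [norm_smul]; simp [hy0], ?_⟩
    rw [map_smul, smul_comm]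
    congr 1
    rw [Matrix.toLpLin_apply, hx']
    rfl
  choose u hu he using hev
  obtain ⟨b, hb, -⟩ := exists_orthonormalBasis_of_eigenvectors hU hp hinj hu he
  exact ⟨μ, b, hb⟩

/-- The weight of `y` on the `k`-th basis vector. -/
noncomputable def weight (u : OrthonormalBasis (Fin N) ℂ (EuclideanSpace ℂ (Fin N)))
    (y : EuclideanSpace ℂ (Fin N)) (k : Fin N) : ℝ := ‖inner ℂ (u k) y‖ ^ 2

lemma sum_weight (u : OrthonormalBasis (Fin N) ℂ (EuclideanSpace ℂ (Fin N)))
    (y : EuclideanSpace ℂ (Fin N)) : ∑ k, weight u y k = ‖y‖ ^ 2 :=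
  u.sum_sq_norm_inner_right y

lemma charpoly_mul_one_sub_vecMulVec {u : OrthonormalBasis (Fin N) ℂ (EuclideanSpace ℂ (Fin N))}
    (h : IsUnimodularEigenbasis U μ u) (y : EuclideanSpace ℂ (Fin N)) (s : ℂ) :
    (U * (1 - s • Matrix.vecMulVec (WithLp.ofLp y) (star (WithLp.ofLp y)))).charpoly
      = nodePoly μ + C s * weightPoly μ (weight u y) := by
  apply eq_of_infinite_eval_eq
  refine Set.Infinite.mono (s := (range μ)ᶜ) (fun z hz => ?_)
    (Set.finite_range μ).infinite_compl
  have hz' : ∀ k, z ≠ μ k := fun k hk => hz ⟨k, hk.symm⟩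
  rw [mem_ofPred_eq, eval_add, eval_mul, eval_C, eval_weightPoly_of_ne _ hz', ← h.charpoly_eq,
    Matrix.eval_charpoly, Matrix.eval_charpoly]
  -- This is `(z - U)⁻¹ U y` expanded in the eigenbasis, so that `z - U + s U y y^* = (z - U)(1 + s
  -- g y^*)` and the matrix determinant lemma applies.
  set g : EuclideanSpace ℂ (Fin N) := ∑ k, (inner ℂ (u k) y * μ k / (z - μ k)) • u k with hg
  have hgU : z • g - Matrix.toEuclideanLin U g = Matrix.toEuclideanLin U y := by
    conv_rhs => rw [← u.sum_repr' y]
    rw [hg, map_sum, map_sum, Finset.smul_sum, ← Finset.sum_sub_distrib]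
    refine Finset.sum_congr rfl fun k _ => ?_
    rw [map_smul, map_smul, h.eigenvector, smul_smul, smul_smul, smul_smul, ← sub_smul]
    congr 1
    have := sub_ne_zero.2 (hz' k)
    field_simp
  have hgv : (Matrix.scalar (Fin N) z - U).mulVec (WithLp.ofLp g) = U.mulVec (WithLp.ofLp y) := by
    have := congrArg WithLp.ofLp hgU
    rw [Matrix.sub_mulVec, Matrix.scalar_apply, ← Matrix.smul_one_eq_diagonal, Matrix.smul_mulVec,
        Matrix.one_mulVec]
    simpa [Matrix.toLpLin_apply] using this
  have hfac : Matrix.scalar (Fin N) z -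
      U * (1 - s • Matrix.vecMulVec (WithLp.ofLp y) (star (WithLp.ofLp y)))
      = (Matrix.scalar (Fin N) z - U) * (1 + Matrix.replicateCol Unit (s • WithLp.ofLp g) *
          Matrix.replicateRow Unit (star (WithLp.ofLp y))) := by
    rw [← Matrix.vecMulVec_eq, mul_add, mul_one, Matrix.mul_vecMulVec, Matrix.mulVec_smul, hgv,
      mul_sub, mul_one, mul_smul_comm, Matrix.mul_vecMulVec, Matrix.smul_vecMulVec]
    abel
  rw [hfac, Matrix.det_mul, Matrix.det_one_add_replicateCol_mul_replicateRow, mul_add, mul_one,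
    mul_left_comm]
  congr 2
  have h1 : star (WithLp.ofLp y) ⬝ᵥ WithLp.ofLp g = inner ℂ y g := by
    rw [EuclideanSpace.inner_eq_star_dotProduct, dotProduct_comm]
  rw [dotProduct_smul, h1, smul_eq_mul, hg, inner_sum]
  congr 1
  refine Finset.sum_congr rfl fun k _ => ?_
  rw [inner_smul_right, weight, ← inner_conj_symm y (u k)]
  have := Complex.mul_conj (inner ℂ (u k) y)
  rw [Complex.normSq_eq_norm_sq] at this
  push_cast at this ⊢
  rw [← this]
  ring

end Eigenbasis

/-! ### Continuous dependence of simple roots -/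

section RootCover

variable {X : Type*} {N : ℕ} {Q : X → ℂ[X]}

lemma isRoot_nodePoly_iff {z : Fin N → ℂ} {a : ℂ} : (nodePoly z).IsRoot a ↔ ∃ k, z k = a := by
  rw [IsRoot.def, eval_nodePoly, Finset.prod_eq_zero_iff]
  simp only [Finset.mem_univ, true_and, sub_eq_zero]
  exact exists_congr fun k => eq_comm

/-- The space of pairs `(x, a)` with `a` a root of `Q x`. -/
def RootCover (Q : X → ℂ[X]) : Type _ := {p : X × ℂ // (Q p.1).IsRoot p.2}

/-- The projection of the root cover to the parameter space. -/
def RootCover.proj (Q : X → ℂ[X]) (e : RootCover Q) : X := e.1.1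

variable [TopologicalSpace X]

instance : TopologicalSpace (RootCover Q) :=
  inferInstanceAs (TopologicalSpace {p : X × ℂ // (Q p.1).IsRoot p.2})

instance [T2Space X] : T2Space (RootCover Q) :=
  inferInstanceAs (T2Space {p : X × ℂ // (Q p.1).IsRoot p.2})

/-- A family of monic polynomials of degree `N` with simple roots and pointwise continuous
values. -/
structure IsSimpleRootFamily (N : ℕ) (Q : X → ℂ[X]) : Prop where
  continuous_eval : ∀ a : ℂ, Continuous fun x => (Q x).eval a
  exists_eq : ∀ x, ∃ z : Fin N → ℂ, Function.Injective z ∧ Q x = nodePoly z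

/-- If no root of `Q x` were within `ε` of `a`, then `|Q x (a)| = ∏ |a - z k| ≥ ε ^ N`, while this
value tends to `0`. -/
lemma IsSimpleRootFamily.eventually_exists_root (h : IsSimpleRootFamily N Q) {x₀ : X} {a : ℂ}
    (ha : (Q x₀).IsRoot a) {ε : ℝ} (hε : 0 < ε) :
    ∀ᶠ x in 𝓝 x₀, ∃ r ∈ Metric.ball a ε, (Q x).IsRoot r := by
  have hlim : Tendsto (fun x => ‖(Q x).eval a‖) (𝓝 x₀) (𝓝 0) := by
    have := ((h.continuous_eval a).norm).tendsto x₀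
    rwa [IsRoot.def.1 ha, norm_zero] at this
  filter_upwards [hlim.eventually_lt_const (pow_pos hε N)] with x hx
  by_contra! hno
  obtain ⟨z, -, hz⟩ := h.exists_eq x
  refine hx.not_ge ?_
  rw [hz, eval_nodePoly, norm_prod]
  calc ε ^ N = ∏ _k : Fin N, ε := by simp
    _ ≤ ∏ k, ‖a - z k‖ := by
      refine Finset.prod_le_prod (fun _ _ => hε.le) fun k _ => ?_
      have h1 : z k ∉ Metric.ball a ε := fun hk =>
        hno _ hk (by rw [hz]; exact isRoot_nodePoly_iff.2 ⟨k, rfl⟩)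
      rw [Metric.mem_ball, not_lt, dist_comm, dist_eq_norm] at h1
      exact h1

lemma eventually_pairwise_disjoint_ball {z : Fin N → ℂ} (hz : Function.Injective z) :
    ∀ᶠ ε in 𝓝[>] (0 : ℝ), ∀ j k, j ≠ k →
      Disjoint (Metric.ball (z j) ε) (Metric.ball (z k) ε) := by
  refine eventually_all.2 fun j => eventually_all.2 fun k => ?_
  by_cases hjk : j = k
  · simp [hjk]
  have hpos : 0 < dist (z j) (z k) / 2 := half_pos (dist_pos.2 (hz.ne hjk))
  filter_upwards [nhdsWithin_le_nhds (eventually_lt_nhds hpos)] with ε hε _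
  exact Metric.ball_disjoint_ball (by linarith)

/-- Each of the `N` disjoint balls catches a root, and there are only `N` roots, so each ball holds
exactly one and none lies elsewhere. -/
lemma IsSimpleRootFamily.eventually_eq_nodePoly (h : IsSimpleRootFamily N Q) {x₀ : X}
    {z : Fin N → ℂ} (hz : Q x₀ = nodePoly z) {ε : ℝ} (hε : 0 < ε)
    (hd : ∀ j k, j ≠ k → Disjoint (Metric.ball (z j) ε) (Metric.ball (z k) ε)) :
    ∀ᶠ x in 𝓝 x₀, ∃ r : Fin N → ℂ, (∀ k, r k ∈ Metric.ball (z k) ε) ∧ Q x = nodePoly r := by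
  have h1 : ∀ᶠ x in 𝓝 x₀, ∀ k, ∃ r ∈ Metric.ball (z k) ε, (Q x).IsRoot r :=
    eventually_all.2 fun k =>
      h.eventually_exists_root (by rw [hz]; exact isRoot_nodePoly_iff.2 ⟨k, rfl⟩) hε
  filter_upwards [h1] with x hx
  choose r hr hroot using hx
  obtain ⟨z', -, hz'⟩ := h.exists_eq x
  simp only [hz', isRoot_nodePoly_iff] at hroot
  choose σ hσ using hroot
  have hinj : Function.Injective σ := by
    intro j k hjk
    by_contra hne
    refine Set.disjoint_left.1 (hd j k hne) (hr j) ?_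
    rw [← hσ j, hjk, hσ k]
    exact hr k
  refine ⟨r, hr, ?_⟩
  rw [hz', nodePoly, nodePoly,
    ← (Equiv.ofBijective σ (Finite.injective_iff_bijective.1 hinj)).prod_comp]
  simp [hσ]

lemma RootCover.mem_nhds_iff {e : RootCover Q} {V : Set (RootCover Q)} :
    V ∈ 𝓝 e ↔ ∃ S ∈ 𝓝 e.1.1, ∃ ε > 0, ∀ e' : RootCover Q,
      e'.1.1 ∈ S → e'.1.2 ∈ Metric.ball e.1.2 ε → e' ∈ V := by
  constructor
  · intro hV
    obtain ⟨T, hT, hTV⟩ := mem_nhds_induced (Subtype.val) e V |>.1 hV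
    obtain ⟨S, hS, B, hB, hSB⟩ := mem_nhds_prod_iff.1 hT
    obtain ⟨ε, hε, hεB⟩ := Metric.mem_nhds_iff.1 hB
    exact ⟨S, hS, ε, hε, fun e' h1 h2 => hTV (hSB ⟨h1, hεB h2⟩)⟩
  · rintro ⟨S, hS, ε, hε, h⟩
    refine mem_nhds_induced (Subtype.val) e V |>.2
      ⟨S ×ˢ Metric.ball e.1.2 ε, prod_mem_nhds hS (Metric.ball_mem_nhds _ hε), fun e' he' => ?_⟩
    exact h e' he'.1 he'.2

lemma RootCover.continuous_proj : Continuous (RootCover.proj Q) :=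
  continuous_fst.comp continuous_subtype_val

lemma RootCover.continuous_root : Continuous fun e : RootCover Q => e.1.2 :=
  continuous_snd.comp continuous_subtype_val

lemma IsSimpleRootFamily.isOpenMap_proj (h : IsSimpleRootFamily N Q) :
    IsOpenMap (RootCover.proj Q) := by
  rw [isOpenMap_iff_nhds_le]
  intro e V hV
  rw [mem_map, RootCover.mem_nhds_iff] at hV
  obtain ⟨S, hS, ε, hε, hV⟩ := hV
  filter_upwards [hS, h.eventually_exists_root e.2 hε] with x hx ⟨r, hr, hroot⟩
  exact hV ⟨(x, r), hroot⟩ hx hr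

lemma IsSimpleRootFamily.isClosedMap_proj (h : IsSimpleRootFamily N Q) :
    IsClosedMap (RootCover.proj Q) := by
  rw [isClosedMap_iff_comap_nhds_le]
  intro x₀ V hV
  obtain ⟨z, hinj, hz⟩ := h.exists_eq x₀
  have hroot : ∀ k, (Q x₀).IsRoot (z k) := fun k => by
    rw [hz]; exact isRoot_nodePoly_iff.2 ⟨k, rfl⟩
  have hV' : ∀ k, ∃ S ∈ 𝓝 x₀, ∃ ε > 0, ∀ e' : RootCover Q,
      e'.1.1 ∈ S → e'.1.2 ∈ Metric.ball (z k) ε → e' ∈ V := fun k =>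
    RootCover.mem_nhds_iff.1 (mem_nhdsSet_iff_forall.1 hV ⟨(x₀, z k), hroot k⟩ rfl)
  choose S hS δ hδ hSV using hV'
  have hsmall : ∀ᶠ ε in 𝓝[>] (0 : ℝ), ∀ k, ε < δ k :=
    eventually_all.2 fun k => nhdsWithin_le_nhds (eventually_lt_nhds (hδ k))
  obtain ⟨ε, ⟨hd, hεδ⟩, hε⟩ := (((eventually_pairwise_disjoint_ball hinj).and hsmall).and
    (self_mem_nhdsWithin : ∀ᶠ ε in 𝓝[>] (0 : ℝ), ε ∈ Ioi (0 : ℝ))).exists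
  refine mem_comap.2 ⟨_, ((eventually_all.2 hS : ∀ᶠ x in 𝓝 x₀, ∀ k, x ∈ S k).and
    (h.eventually_eq_nodePoly hz hε hd)), ?_⟩
  rintro e ⟨he, r, hr, hQ⟩
  have hre := e.2
  change Q e.1.1 = nodePoly r at hQ
  rw [hQ, isRoot_nodePoly_iff] at hre
  obtain ⟨k, hk⟩ := hre
  exact hSV k e (he k) (by rw [← hk]; exact Metric.ball_subset_ball (hεδ k).le (hr k))

lemma IsSimpleRootFamily.isLocalHomeomorph_proj (h : IsSimpleRootFamily N Q) :
    IsLocalHomeomorph (RootCover.proj Q) := by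
  rw [isLocalHomeomorph_iff_isOpenEmbedding_restrict]
  intro e
  obtain ⟨z, hinj, hz⟩ := h.exists_eq e.1.1
  obtain ⟨ε, hd, hε⟩ := ((eventually_pairwise_disjoint_ball hinj).and
    (self_mem_nhdsWithin : ∀ᶠ ε in 𝓝[>] (0 : ℝ), ε ∈ Ioi (0 : ℝ))).exists
  obtain ⟨S, hS, hSo, heS⟩ := mem_nhds_iff.1 (h.eventually_eq_nodePoly hz hε hd)
  let V : Set (RootCover Q) := {e' | e'.1.1 ∈ S ∧ e'.1.2 ∈ Metric.ball e.1.2 ε}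
  have hVo : IsOpen V := (hSo.preimage RootCover.continuous_proj).inter
    (Metric.isOpen_ball.preimage RootCover.continuous_root)
  refine ⟨V, hVo.mem_nhds ⟨heS, Metric.mem_ball_self hε⟩, ?_⟩
  refine IsOpenEmbedding.of_continuous_injective_isOpenMap
    (RootCover.continuous_proj.comp continuous_subtype_val) ?_ (h.isOpenMap_proj.domRestrict hVo)
  obtain ⟨j, hj⟩ : ∃ j, z j = e.1.2 := isRoot_nodePoly_iff.1 (by rw [← hz]; exact e.2)
  rintro ⟨⟨⟨x, a⟩, ha⟩, hxa, hax⟩ ⟨⟨⟨y, b⟩, hb⟩, hyb, hby⟩ hxy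
  obtain rfl : x = y := hxy
  obtain ⟨r, hr, hQ⟩ := hS hxa
  have hloc : ∀ c, (Q x).IsRoot c → c ∈ Metric.ball e.1.2 ε → c = r j := by
    intro c hc hce
    rw [hQ, isRoot_nodePoly_iff] at hc
    obtain ⟨k, rfl⟩ := hc
    by_cases hkj : k = j
    · rw [hkj]
    · exact absurd (by rw [hj]; exact hce) (Set.disjoint_left.1 (hd k j hkj) (hr k))
  have hab : a = b := (hloc a ha hax).trans (hloc b hb hby).symm
  subst hab
  rfl

/-- A closed local homeomorphism with finite fibres is a covering map. Closedness expresses that no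
root escapes the balls around the roots at `x₀`. -/
lemma IsSimpleRootFamily.isCoveringMap_proj [T2Space X] (h : IsSimpleRootFamily N Q) :
    IsCoveringMap (RootCover.proj Q) := by
  rw [isCoveringMap_iff_isCoveringMapOn_univ]
  refine h.isClosedMap_proj.isCoveringMapOn_of_isLocalHomeomorphOn (fun x _ => ?_) ?_
  · obtain ⟨z, -, hz⟩ := h.exists_eq x
    refine Set.Finite.of_finite_image (f := fun e : RootCover Q => e.1.2)
      ((Set.finite_range z).subset ?_) ?_
    · rintro _ ⟨e, he, rfl⟩
      have := e.2
      rw [show e.1.1 = x from he, hz, isRoot_nodePoly_iff] at this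
      exact this
    · intro e he e' he' hee'
      exact Subtype.ext (Prod.ext ((he : e.1.1 = x).trans (he' : e'.1.1 = x).symm) hee')
  · exact isLocalHomeomorph_iff_isLocalHomeomorphOn_univ.1 h.isLocalHomeomorph_proj

/-- Continuous selections of a simple root over a connected base are determined by one value. -/
lemma IsSimpleRootFamily.eq_of_apply_eq [T2Space X] [PreconnectedSpace X]
    (h : IsSimpleRootFamily N Q) {f g : X → ℂ} (hf : Continuous f) (hg : Continuous g)
    (hfr : ∀ x, (Q x).IsRoot (f x)) (hgr : ∀ x, (Q x).IsRoot (g x)) {x₀ : X}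
    (h0 : f x₀ = g x₀) : f = g := by
  have := h.isCoveringMap_proj.eq_of_comp_eq (A := X)
    (g₁ := fun x => (⟨(x, f x), hfr x⟩ : RootCover Q))
    (g₂ := fun x => (⟨(x, g x), hgr x⟩ : RootCover Q))
    (Continuous.subtype_mk (continuous_id.prodMk hf) _)
    (Continuous.subtype_mk (continuous_id.prodMk hg) _) rfl x₀
    (Subtype.ext (Prod.ext rfl h0))
  funext x
  exact congrArg (fun e : RootCover Q => e.1.2) (congrFun this x)

end RootCover

/-! ### Eigenvalue flows -/

section Flow

variable {N : ℕ} {U : Matrix (Fin N) (Fin N) ℂ} {μ : Fin N → ℂ} {w : Fin N → ℝ}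

lemma perturbed_one (U : Matrix (Fin N) (Fin N) ℂ) (v : EuclideanSpace ℂ (Fin N)) :
    perturbed U v 1 = U := by
  simp [perturbed]

lemma charpoly_perturbed {u : OrthonormalBasis (Fin N) ℂ (EuclideanSpace ℂ (Fin N))}
    (h : IsUnimodularEigenbasis U μ u) (v : EuclideanSpace ℂ (Fin N)) (t : ℝ) :
    (perturbed U v t).charpoly = nodePoly μ + C (1 - (t : ℂ)) * weightPoly μ (weight u v) :=
  charpoly_mul_one_sub_vecMulVec h v _

/-- Differentiability of a continuous root of the pencil `P + (1 - t) W` at a simple root. -/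
lemma hasDerivWithinAt_root_of_pencil {P W : ℂ[X]} {S : Set ℝ} {t : ℝ} {lam : ℝ → ℂ}
    {z : Fin N → ℂ} {j : Fin N} (hinj : Function.Injective z)
    (hz : P + C (1 - (t : ℂ)) * W = nodePoly z) (hzj : lam t = z j)
    (hroot : ∀ s ∈ S, (P + C (1 - (s : ℂ)) * W).IsRoot (lam s))
    (hc : ContinuousWithinAt lam S t) :
    HasDerivWithinAt lam (W.eval (z j) / ∏ k ∈ Finset.univ.erase j, (z j - z k)) S t := by
  rw [hasDerivWithinAt_iff_tendsto_slope]
  have hc' : Tendsto lam (𝓝[S \ {t}] t) (𝓝 (z j)) := by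
    rw [← hzj]; exact hc.tendsto.mono_left (nhdsWithin_mono _ sdiff_subset)
  have hR0 : ∏ k ∈ Finset.univ.erase j, (z j - z k) ≠ 0 :=
    Finset.prod_ne_zero_iff.2 fun k hk =>
      sub_ne_zero.2 (hinj.ne (Finset.ne_of_mem_erase hk).symm)
  have hRlim : Tendsto (fun s => ∏ k ∈ Finset.univ.erase j, (lam s - z k)) (𝓝[S \ {t}] t)
      (𝓝 (∏ k ∈ Finset.univ.erase j, (z j - z k))) :=
    tendsto_finsetProd _ fun k _ => hc'.sub_const _
  have hlim : Tendsto (fun s => W.eval (lam s) / ∏ k ∈ Finset.univ.erase j, (lam s - z k))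
      (𝓝[S \ {t}] t) (𝓝 (W.eval (z j) / ∏ k ∈ Finset.univ.erase j, (z j - z k))) :=
    (((W.continuous.tendsto _).comp hc').div hRlim hR0)
  refine hlim.congr' ?_
  filter_upwards [hRlim.eventually_ne hR0, self_mem_nhdsWithin] with s hs hsS
  -- Subtracting the equations at times `s` and `t`, both evaluated at `lam s`, gives `(lam s - z j)
  -- * ∏_{k ≠ j} (lam s - z k) = (s - t) * W(lam s)`. The slope is therefore explicit, and
  -- continuity of `lam` suffices for the limit.
  have h1 := congrArg (eval (lam s)) hz
  have h2 := IsRoot.def.1 (hroot s hsS.1)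
  rw [eval_nodePoly, ← Finset.mul_prod_erase Finset.univ _ (Finset.mem_univ j)] at h1
  simp only [eval_add, eval_mul, eval_C] at h1 h2
  have hst : (s : ℂ) - t ≠ 0 := by
    rw [← Complex.ofReal_sub]
    exact_mod_cast sub_ne_zero.2 hsS.2
  rw [slope_def_module, hzj, Complex.real_smul, div_eq_iff hs]
  push_cast
  field_simp
  linear_combination h1 - h2

lemma injective_exp_angle (hs : HasSimpleSpectrum U) {θ : Fin N → ℝ}
    {u : Fin N → EuclideanSpace ℂ (Fin N)} (h : IsEigenData U θ u) :
    Function.Injective fun j => Complex.exp (Complex.I * θ j) := by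
  rw [← nodup_roots_nodePoly]
  have h1 := h.charpoly_eq
  rw [HasSimpleSpectrum, h1] at hs
  exact hs

lemma IsEigenData.exists_basis (hU : U ∈ Matrix.unitaryGroup (Fin N) ℂ)
    (hs : HasSimpleSpectrum U) {θ : Fin N → ℝ}
    {u : Fin N → EuclideanSpace ℂ (Fin N)} (h : IsEigenData U θ u) :
    ∃ b : OrthonormalBasis (Fin N) ℂ (EuclideanSpace ℂ (Fin N)),
      IsUnimodularEigenbasis U (fun j => Complex.exp (Complex.I * θ j)) b ∧ ∀ k, b k = u k :=
  exists_orthonormalBasis_of_eigenvectors hU h.charpoly_eq (injective_exp_angle hs h)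
    h.norm_eq_one h.eigenvector

lemma initialVelocity_eq {u : Fin N → EuclideanSpace ℂ (Fin N)} {θ : Fin N → ℝ}
    {b : OrthonormalBasis (Fin N) ℂ (EuclideanSpace ℂ (Fin N))} (hb : ∀ k, b k = u k)
    (hinj : Function.Injective fun j => Complex.exp (Complex.I * θ j))
    (v : EuclideanSpace ℂ (Fin N)) (j : Fin N) :
    initialVelocity v θ u j
      = (weightPoly (fun j => Complex.exp (Complex.I * θ j)) (weight b v)).eval
          (Complex.exp (Complex.I * θ j)) /
        ∏ k ∈ Finset.univ.erase j,
          (Complex.exp (Complex.I * θ j) - Complex.exp (Complex.I * θ k)) := by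
  have h0 : ∏ k ∈ Finset.univ.erase j,
      (Complex.exp (Complex.I * θ j) - Complex.exp (Complex.I * θ k)) ≠ 0 :=
    Finset.prod_ne_zero_iff.2 fun k hk =>
      sub_ne_zero.2 (hinj.ne (Finset.ne_of_mem_erase hk).symm)
  rw [eval_weightPoly_node (μ := fun j => Complex.exp (Complex.I * θ j)), eq_div_iff h0,
    initialVelocity, weight, hb]
  push_cast
  ring

lemma flow_hasDeriv (hU : U ∈ Matrix.unitaryGroup (Fin N) ℂ) (hs : HasSimpleSpectrum U)
    {θ : Fin N → ℝ} {u : Fin N → EuclideanSpace ℂ (Fin N)} (h : IsEigenData U θ u)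
    {v : EuclideanSpace ℂ (Fin N)} (hv : ‖v‖ = 1) {lam : Fin N → ℝ → ℂ}
    (hl : IsEigenvalueFlow U v θ lam) :
    HasInitialVelocity v θ u lam ∧
      ∀ t ∈ Ioo (0 : ℝ) 1, (Function.Injective fun k => lam k t) →
        ∀ j, HasDerivAt (lam j) (velocity t (fun k => lam k t) j) t := by
  obtain ⟨b, hb, hbu⟩ := h.exists_basis hU hs
  set μ : Fin N → ℂ := fun j => Complex.exp (Complex.I * θ j) with hμ
  have hw : ∑ k, weight b v k = 1 := by rw [sum_weight, hv, one_pow]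
  have hpoly : ∀ t ∈ Ioc (0 : ℝ) 1, nodePoly (fun k => lam k t)
      = nodePoly μ + C (1 - (t : ℂ)) * weightPoly μ (weight b v) := fun t ht => by
    rw [← charpoly_perturbed hb, hl.charpoly_eq t ht]; rfl
  have hroot : ∀ j, ∀ t ∈ Ioc (0 : ℝ) 1,
      (nodePoly μ + C (1 - (t : ℂ)) * weightPoly μ (weight b v)).IsRoot (lam j t) :=
    fun j t ht => by rw [← hpoly t ht]; exact isRoot_nodePoly_iff.2 ⟨j, rfl⟩
  have hone : (1 : ℝ) ∈ Ioc (0 : ℝ) 1 := by simp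
  have hnhds : 𝓝[Ioc (0 : ℝ) 1] 1 = 𝓝[Iic 1] 1 :=
    nhdsWithin_Ioc_eq_nhdsLE one_pos
  have hlim : ∀ j, Tendsto (lam j) (𝓝[<] 1) (𝓝 (μ j)) := fun j => by
    have h1 := (hl.continuousOn j 1 hone).tendsto
    rw [hnhds, hl.init] at h1
    exact h1.mono_left (nhdsWithin_mono _ Iio_subset_Iic_self)
  refine ⟨fun j => ⟨?_, ?_⟩, fun t ht hinj j => ?_⟩
  · rw [initialVelocity_eq hbu hb.injective]
    have := hasDerivWithinAt_root_of_pencil (P := nodePoly μ) (W := weightPoly μ (weight b v))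
      (S := Ioc (0 : ℝ) 1) (t := 1) (lam := lam j) (z := μ) (j := j) hb.injective (by simp)
      (hl.init j) (hroot j) (hl.continuousOn j 1 hone)
    rw [HasDerivWithinAt, hnhds] at this
    exact this
  · rw [initialVelocity_eq hbu hb.injective]
    have h0 : ∏ k ∈ Finset.univ.erase j, (μ j - μ k) ≠ 0 :=
      Finset.prod_ne_zero_iff.2 fun k hk =>
        sub_ne_zero.2 (hb.injective.ne (Finset.ne_of_mem_erase hk).symm)
    have h1 : Tendsto (fun t => (weightPoly μ (weight b v)).eval (lam j t) /
        ∏ k ∈ Finset.univ.erase j, (lam j t - lam k t)) (𝓝[<] 1)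
        (𝓝 ((weightPoly μ (weight b v)).eval (μ j) /
          ∏ k ∈ Finset.univ.erase j, (μ j - μ k))) :=
      (((Polynomial.continuous _).tendsto _).comp (hlim j)).div
        (tendsto_finsetProd _ fun k _ => (hlim j).sub (hlim k)) h0
    refine h1.congr' ?_
    filter_upwards [Ioo_mem_nhdsLT (zero_lt_one' ℝ)] with t ht
    exact (velocity_eq hw hb.norm_eq_one ht (hpoly t (Ioo_subset_Ioc_self ht)) j).symm
  · rw [velocity_eq hw hb.norm_eq_one ht (hpoly t (Ioo_subset_Ioc_self ht)) j]
    have hmem : Ioc (0 : ℝ) 1 ∈ 𝓝 t := mem_of_superset (Ioo_mem_nhds ht.1 ht.2) Ioo_subset_Ioc_self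
    exact (hasDerivWithinAt_root_of_pencil hinj (hpoly t (Ioo_subset_Ioc_self ht)).symm rfl
      (hroot j) (hl.continuousOn j t (Ioo_subset_Ioc_self ht))).hasDerivAt hmem

/-- The clamped exponential, a map from the line to `(0, 1]`. -/
noncomputable def expClamp : C(ℝ, Ioc (0 : ℝ) 1) :=
  ⟨fun s => ⟨min (Real.exp s) 1, lt_min (Real.exp_pos s) one_pos, min_le_right _ _⟩,
    Continuous.subtype_mk (by fun_prop) _⟩

lemma expClamp_log (t : Ioc (0 : ℝ) 1) : expClamp (Real.log t) = t := by
  apply Subtype.ext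
  change min (Real.exp (Real.log t)) 1 = t
  rw [Real.exp_log t.2.1, min_eq_left t.2.2]

/-- A simple root of a member of the family extends to a continuous choice of roots. -/
lemma IsSimpleRootFamily.exists_continuous_root {Q : Ioc (0 : ℝ) 1 → ℂ[X]}
    (h : IsSimpleRootFamily N Q) {t₀ : Ioc (0 : ℝ) 1} {a : ℂ} (ha : (Q t₀).IsRoot a) :
    ∃ f : Ioc (0 : ℝ) 1 → ℂ, Continuous f ∧ (∀ t, (Q t).IsRoot (f t)) ∧ f t₀ = a := by
  -- The lift is taken over the simply connected line, then pulled back along `log`, a right inverse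
  -- of `expClamp`.
  obtain ⟨F, ⟨hF0, hF⟩, -⟩ := h.isCoveringMap_proj.existsUnique_continuousMap_lifts expClamp
    (Real.log t₀) (⟨(t₀, a), ha⟩ : RootCover Q) (expClamp_log t₀).symm
  have hlog : Continuous fun t : Ioc (0 : ℝ) 1 => Real.log t :=
    Real.continuousOn_log.comp_continuous continuous_subtype_val fun t => t.2.1.ne'
  refine ⟨fun t => (F (Real.log t)).1.2,
    RootCover.continuous_root.comp (F.continuous.comp hlog), fun t => ?_, 
    congrArg (fun e : RootCover Q => e.1.2) hF0⟩
  have h1 : (F (Real.log t)).1.1 = t := (congrFun hF (Real.log t)).trans (expClamp_log t)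
  have h2 := (F (Real.log t)).2
  rw [h1] at h2
  exact h2

/-- If all `G(t)` have simple spectrum there is exactly one flow, and it has no collisions. -/
lemma exists_unique_flow {θ : Fin N → ℝ} {u : Fin N → EuclideanSpace ℂ (Fin N)}
    (h : IsEigenData U θ u) {v : EuclideanSpace ℂ (Fin N)}
    (hs : ∀ t ∈ Ioc (0 : ℝ) 1, HasSimpleSpectrum (perturbed U v t)) :
    ∃ lam : Fin N → ℝ → ℂ, IsEigenvalueFlow U v θ lam ∧
      (∀ lam' : Fin N → ℝ → ℂ, IsEigenvalueFlow U v θ lam' → ∀ j, EqOn (lam' j) (lam j) (Ioc 0 1)) ∧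
      ∀ t ∈ Ioc (0 : ℝ) 1, Function.Injective fun k => lam k t := by
  have hone : (1 : ℝ) ∈ Ioc (0 : ℝ) 1 := by simp
  set Q : Ioc (0 : ℝ) 1 → ℂ[X] := fun t => (perturbed U v t).charpoly with hQ
  have hfam : IsSimpleRootFamily N Q := by
    refine ⟨fun a => ?_, fun t => ?_⟩
    · simp only [hQ, Matrix.eval_charpoly, perturbed]
      fun_prop
    · exact (hs t t.2).exists_charpoly_eq
  have hpre : PreconnectedSpace (Ioc (0 : ℝ) 1) :=
    isPreconnected_iff_preconnectedSpace.1 isPreconnected_Ioc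
  have hQ1 : Q ⟨1, hone⟩ = nodePoly fun j => Complex.exp (Complex.I * θ j) := by
    simp only [hQ, perturbed_one]
    exact h.charpoly_eq
  have hinj0 : Function.Injective fun j => Complex.exp (Complex.I * θ j) := by
    rw [← nodup_roots_nodePoly, ← hQ1]
    exact hs 1 hone
  have hex : ∀ j, ∃ f : Ioc (0 : ℝ) 1 → ℂ, Continuous f ∧ (∀ t, (Q t).IsRoot (f t)) ∧
      f ⟨1, hone⟩ = Complex.exp (Complex.I * θ j) := fun j =>
    hfam.exists_continuous_root (by rw [hQ1]; exact isRoot_nodePoly_iff.2 ⟨j, rfl⟩)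
  choose f hfc hfr hf1 using hex
  -- Two trajectories meeting at any time would coincide throughout, in particular at time `1`,
  -- where they are distinct.
  have hinj : ∀ t, Function.Injective fun j => f j t := fun t j k hjk => by
    have := hfam.eq_of_apply_eq (hfc j) (hfc k) (hfr j) (hfr k) hjk
    apply hinj0
    simp only [← hf1, this]
  have hfQ : ∀ t, Q t = nodePoly fun j => f j t := fun t => by
    obtain ⟨z, hz, hQz⟩ := hfam.exists_eq t
    have hk : ∀ j, ∃ k, z k = f j t := fun j => isRoot_nodePoly_iff.1 (hQz ▸ hfr j t)
    choose σ hσ using hk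
    have hσi : Function.Injective σ := fun j k hjk => hinj t (by
      change f j t = f k t
      rw [← hσ, ← hσ, hjk])
    rw [hQz, nodePoly, nodePoly,
      ← (Equiv.ofBijective σ (Finite.injective_iff_bijective.1 hσi)).prod_comp]
    simp [hσ]
  let lam : Fin N → ℝ → ℂ := fun j t => if ht : t ∈ Ioc (0 : ℝ) 1 then f j ⟨t, ht⟩ else 0
  have hlam : ∀ j (t : ℝ) (ht : t ∈ Ioc (0 : ℝ) 1), lam j t = f j ⟨t, ht⟩ := fun j t ht =>
    dif_pos ht
  refine ⟨lam, ⟨fun j => ?_, fun t ht => ?_, fun j => ?_⟩, fun lam' hl' j => ?_, fun t ht => ?_⟩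
  · rw [continuousOn_iff_continuous_domRestrict]
    convert! hfc j using 1
    funext t
    exact hlam j t t.2
  · simp only [hlam _ t ht]
    exact hfQ ⟨t, ht⟩
  · rw [hlam j 1 hone, hf1]
  · have hc' := hl'.continuousOn j
    rw [continuousOn_iff_continuous_domRestrict] at hc'
    have heq := hfam.eq_of_apply_eq hc' (hfc j) (fun t => ?_) (hfr j) (x₀ := ⟨1, hone⟩)
      ((hl'.init j).trans (hf1 j).symm)
    · intro t ht
      rw [hlam j t ht]
      exact congrFun heq ⟨t, ht⟩
    · have h1 : Q t = nodePoly fun k => lam' k t := hl'.charpoly_eq t t.2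
      rw [h1]
      exact isRoot_nodePoly_iff.2 ⟨j, rfl⟩
  · simp only [hlam _ t ht]
    exact hinj ⟨t, ht⟩

end Flow

/-! ### Critical points of the secular function with real critical value -/

section Secular

/-- If `A' = c B'` with `c` non-real, then `Im A = Im B = 0` cuts out a countable set of points. -/
lemma countable_common_zeros_im {A B D c : ℂ → ℂ} {S : Set ℂ}
    (hB : ∀ z ∈ S, HasDerivAt B (D z) z) (hA : ∀ z ∈ S, HasDerivAt A (c z * D z) z)
    (hc : ∀ z ∈ S, (c z).im ≠ 0) (hD : ∀ z ∈ S, D z ≠ 0) :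
    {z ∈ S | (A z).im = 0 ∧ (B z).im = 0}.Countable := by
  set T := {z ∈ S | (A z).im = 0 ∧ (B z).im = 0} with hT
  have hdisc : DiscreteTopology T := by
    rw [discreteTopology_subtype_iff]
    intro z hz
    let LA : ℂ →L[ℝ] ℂ :=
      (ContinuousLinearMap.toSpanSingleton ℂ (c z * D z)).restrictScalars ℝ
    let LB : ℂ →L[ℝ] ℂ := (ContinuousLinearMap.toSpanSingleton ℂ (D z)).restrictScalars ℝ
    let L : ℂ →L[ℝ] ℝ × ℝ := (Complex.imCLM.comp LA).prod (Complex.imCLM.comp LB)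
    have hF : HasFDerivAt (fun z => ((A z).im, (B z).im)) L z :=
      (Complex.imCLM.hasFDerivAt.comp z ((hA z hz.1).hasFDerivAt.restrictScalars ℝ)).prodMk
        (Complex.imCLM.hasFDerivAt.comp z ((hB z hz.1).hasFDerivAt.restrictScalars ℝ))
    -- If `h D` is real and `c h D` is real with `c` non-real, then `h D = 0`. So the real
    -- derivative of `(Im A, Im B)` is injective and its zeros are isolated.
    have hker : LinearMap.ker (L : ℂ →ₗ[ℝ] ℝ × ℝ) = ⊥ := by
      rw [LinearMap.ker_eq_bot']
      intro h hh
      have h1 : (h * (c z * D z)).im = 0 := congrArg Prod.fst hh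
      have h2 : (h * D z).im = 0 := congrArg Prod.snd hh
      rw [mul_left_comm, Complex.mul_im, h2, mul_zero, zero_add] at h1
      have h3 : (h * D z).re = 0 := (mul_eq_zero.1 h1).resolve_left (hc z hz.1)
      exact (mul_eq_zero.1 (Complex.ext h3 h2)).resolve_right (hD z hz.1)
    obtain ⟨K, -, hK⟩ := (L : ℂ →ₗ[ℝ] ℝ × ℝ).exists_antilipschitzWith hker
    have hne := hF.eventually_ne (c := (0, 0)) ⟨K, hK⟩
    rw [inf_principal_eq_bot]
    filter_upwards [hne] with x hx hxT
    exact hx (Prod.ext hxT.2.1 hxT.2.2)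
  exact countable_coe_iff.1 countable_of_Lindelof_of_discrete

variable {N : ℕ} {μ : Fin N → ℂ}

lemma finite_zeros_sum_inv_cube (hμ : Function.Injective μ) {s : Finset (Fin N)} {e : Fin N → ℂ}
    {k₀ : Fin N} (hk₀ : k₀ ∈ s) (he : e k₀ ≠ 0) :
    {z : ℂ | (∀ k, z ≠ μ k) ∧ ∑ k ∈ s, e k / (z - μ k) ^ 3 = 0}.Finite := by
  let R : ℂ[X] := ∑ k ∈ s, C (e k) * ∏ l ∈ s.erase k, (X - C (μ l)) ^ 3
  have hR : R ≠ 0 := by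
    intro h
    have h1 := congrArg (eval (μ k₀)) h
    simp only [R, eval_finsetSum, eval_mul, eval_C, eval_prod, eval_pow, eval_sub, eval_X,
      eval_zero] at h1
    rw [Finset.sum_eq_single_of_mem k₀ hk₀ fun k _ hk => by
      rw [Finset.prod_eq_zero (Finset.mem_erase.2 ⟨hk.symm, hk₀⟩) (by simp), mul_zero]] at h1
    exact mul_ne_zero he (Finset.prod_ne_zero_iff.2 fun l hl =>
      pow_ne_zero _ (sub_ne_zero.2 (hμ.ne (Finset.ne_of_mem_erase hl).symm))) h1
  refine (finite_setOfPred_isRoot hR).subset fun z hz => ?_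
  have h1 : R.eval z = (∏ l ∈ s, (z - μ l) ^ 3) * ∑ k ∈ s, e k / (z - μ k) ^ 3 := by
    simp only [R, eval_finsetSum, eval_mul, eval_C, eval_prod, eval_pow, eval_sub, eval_X]
    rw [Finset.mul_sum]
    refine Finset.sum_congr rfl fun k hk => ?_
    have := sub_ne_zero.2 (hz.1 k)
    rw [← Finset.mul_prod_erase s _ hk]
    field_simp
  change R.eval z = 0
  rw [h1, hz.2, mul_zero]

/-- The values of the `j`-th weight for which the secular function `∑ w k μ k / (z - μ k)` has a
critical point off the line through `μ j` with real critical value. -/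
lemma countable_critical_weights (hμ : Function.Injective μ) (hμ0 : ∀ k, μ k ≠ 0) (j : Fin N)
    {a : Fin N → ℝ} {k₀ : Fin N} (hk₀ : k₀ ≠ j) (ha : a k₀ ≠ 0) :
    {x : ℝ | ∃ z : ℂ, (∀ k, z ≠ μ k) ∧ (z / μ j).im ≠ 0 ∧
      (x * μ j / (z - μ j) + ∑ k ∈ Finset.univ.erase j, (a k : ℂ) * μ k / (z - μ k)).im = 0 ∧
      x * μ j / (z - μ j) ^ 2 +
        ∑ k ∈ Finset.univ.erase j, (a k : ℂ) * μ k / (z - μ k) ^ 2 = 0}.Countable := by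
  -- Solving the critical equation for `x` gives `x = A z`; substituting this into the secular
  -- function gives `B z`. Here `D` is the derivative of `B`.
  let A : ℂ → ℂ := fun z => ∑ k ∈ Finset.univ.erase j,
    -((a k : ℂ) * μ k) / μ j * ((z - μ j) / (z - μ k)) ^ 2
  let B : ℂ → ℂ := fun z => ∑ k ∈ Finset.univ.erase j,
    (a k : ℂ) * μ k * (μ j - μ k) / (z - μ k) ^ 2
  let e : Fin N → ℂ := fun k => (a k : ℂ) * μ k * (μ j - μ k) * (-2)
  let D : ℂ → ℂ := fun z => ∑ k ∈ Finset.univ.erase j, e k / (z - μ k) ^ 3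
  let S : Set ℂ := {z | (∀ k, z ≠ μ k) ∧ (z / μ j).im ≠ 0}
  have hB : ∀ z ∈ S, HasDerivAt B (D z) z := by
    intro z hz
    refine HasDerivAt.fun_sum fun k _ => ?_
    have h0 := sub_ne_zero.2 (hz.1 k)
    have h1 := (((hasDerivAt_id z).sub_const (μ k)).pow 2).inv (pow_ne_zero 2 h0)
    have h2 := h1.const_mul ((a k : ℂ) * μ k * (μ j - μ k))
    refine (h2.congr_deriv ?_).congr_of_eventuallyEq (Eventually.of_forall fun x => ?_)
    · simp only [id, e, Pi.pow_apply, Nat.add_one_sub_one, pow_one, Nat.cast_ofNat]; field_simp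
    · simp [div_eq_mul_inv]
  have hA : ∀ z ∈ S, HasDerivAt A ((z - μ j) / μ j * D z) z := by
    intro z hz
    rw [Finset.mul_sum]
    refine HasDerivAt.fun_sum fun k _ => ?_
    have h0 := sub_ne_zero.2 (hz.1 k)
    have h1 := (((hasDerivAt_id z).sub_const (μ j)).div ((hasDerivAt_id z).sub_const (μ k)) h0).pow 2
    have h2 := h1.const_mul (-((a k : ℂ) * μ k) / μ j)
    refine h2.congr_deriv ?_
    have := hμ0 j
    simp only [id, e, Pi.div_apply, Nat.add_one_sub_one, pow_one, Nat.cast_ofNat]; field_simp; ring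
  have him : ∀ z, ((z - μ j) / μ j).im = (z / μ j).im := fun z => by
    rw [sub_div, div_self (hμ0 j), Complex.sub_im, Complex.one_im, sub_zero]
  have hfin : {z | (∀ k, z ≠ μ k) ∧ D z = 0}.Finite := by
    refine finite_zeros_sum_inv_cube hμ (Finset.mem_erase.2 ⟨hk₀, Finset.mem_univ _⟩) ?_
    exact mul_ne_zero (mul_ne_zero (mul_ne_zero (by exact_mod_cast ha) (hμ0 _))
      (sub_ne_zero.2 (hμ.ne hk₀.symm))) (by norm_num)
  have hcount : {z ∈ S | (A z).im = 0 ∧ (B z).im = 0}.Countable := by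
    refine ((countable_common_zeros_im (S := {z ∈ S | D z ≠ 0}) (fun z hz => hB z hz.1)
      (fun z hz => hA z hz.1) (fun z hz => by rw [him]; exact hz.1.2) (fun z hz => hz.2)).union
      hfin.countable).mono ?_
    rintro z ⟨hz, hz'⟩
    by_cases hD : D z = 0
    · exact Or.inr ⟨hz.1, hD⟩
    · exact Or.inl ⟨⟨hz, hD⟩, hz'⟩
  refine (hcount.image fun z => (A z).re).mono ?_
  rintro x ⟨z, hz, hzim, hreal, hcrit⟩
  have h0 := sub_ne_zero.2 (hz j)
  have h1 : A z = x := by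
    have : A z = -((z - μ j) ^ 2 / μ j) *
        ∑ k ∈ Finset.univ.erase j, (a k : ℂ) * μ k / (z - μ k) ^ 2 := by
      rw [Finset.mul_sum]
      refine Finset.sum_congr rfl fun k _ => ?_
      have := sub_ne_zero.2 (hz k)
      have := hμ0 j
      field_simp
    rw [this, eq_neg_of_add_eq_zero_right hcrit]
    have := hμ0 j
    field_simp
  have h2 : B z = x * μ j / (z - μ j) +
      ∑ k ∈ Finset.univ.erase j, (a k : ℂ) * μ k / (z - μ k) := by
    have h3 : x * μ j / (z - μ j) = (z - μ j) * (x * μ j / (z - μ j) ^ 2) := by field_simp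
    rw [h3, eq_neg_of_add_eq_zero_left hcrit, mul_neg, Finset.mul_sum, ← Finset.sum_neg_distrib,
      ← Finset.sum_add_distrib]
    refine Finset.sum_congr rfl fun k _ => ?_
    have := sub_ne_zero.2 (hz k)
    field_simp
    ring
  exact ⟨z, ⟨⟨hz, hzim⟩, by rw [h1, Complex.ofReal_im], by rw [h2]; exact hreal⟩,
    by simp only [h1, Complex.ofReal_re]⟩

/-- A critical point of the secular function at which its value is real and less than `-1` (relative
to the total weight) lies off the line through some `μ j`. -/
lemma exists_im_ne_zero_of_critical (hμ : Function.Injective μ) (hn : ∀ k, ‖μ k‖ = 1)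
    {w : Fin N → ℝ} (hw : ∀ k, 0 < w k) {s : ℝ} (hs : 0 < s) (hsw : s * ∑ k, w k < 1) {z : ℂ}
    (hz0 : z ≠ 0) (hz : ∀ k, z ≠ μ k)
    (h1 : 1 + (s : ℂ) * ∑ k, (w k : ℂ) * μ k / (z - μ k) = 0)
    (h2 : ∑ k, (w k : ℂ) * μ k / (z - μ k) ^ 2 = 0) :
    ∃ j k, k ≠ j ∧ (z / μ j).im ≠ 0 := by
  have hμ0 : ∀ k, μ k ≠ 0 := fun k => norm_ne_zero_iff.1 (by rw [hn]; norm_num)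
  by_contra! hno
  -- A nonzero `z` spans one real line through the origin, which meets the unit circle in two
  -- antipodal points. Hence at most two nodes are possible.
  have hreal : ∀ j k, k ≠ j → μ k = -μ j := by
    intro j k hkj
    have hj := Complex.ext (z := z / μ j) (w := ((z / μ j).re : ℂ)) (by simp) (by simp [hno j k hkj])
    have hk := Complex.ext (z := z / μ k) (w := ((z / μ k).re : ℂ)) (by simp)
      (by simp [hno k j hkj.symm])
    set r := (z / μ j).re
    set q := (z / μ k).re
    have hr : |r| = ‖z‖ := by
      have := congrArg norm hj
      rw [norm_div, hn, div_one, Complex.norm_real] at this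
      exact this.symm
    have hq : |q| = ‖z‖ := by
      have := congrArg norm hk
      rw [norm_div, hn, div_one, Complex.norm_real] at this
      exact this.symm
    rw [div_eq_iff (hμ0 _)] at hj hk
    have hr0 : (r : ℂ) ≠ 0 := fun h => hz0 (by rw [hj, h, zero_mul])
    rcases abs_eq_abs.1 (hr.trans hq.symm) with h | h
    · exact absurd (hμ (mul_left_cancel₀ hr0 (by rw [← hj, h, ← hk]))) hkj.symm
    · have hqr : (q : ℂ) = -r := by rw [h]; simp
      rw [hqr] at hk
      exact mul_left_cancel₀ hr0 (by linear_combination hk - hj)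
  match N, μ, w with
  | 0, _, _ => simp at h1
  | 1, μ, w =>
    rw [Fin.sum_univ_one] at h2
    have hw0 : (w 0 : ℂ) ≠ 0 := by exact_mod_cast (hw 0).ne'
    exact div_ne_zero (mul_ne_zero hw0 (hμ0 0)) (pow_ne_zero 2 (sub_ne_zero.2 (hz 0))) h2
  | 2, μ, w =>
    have h3 := hreal 0 1 (by decide)
    have hj := Complex.ext (z := z / μ 0) (w := ((z / μ 0).re : ℂ)) (by simp)
      (by simp [hno 0 1 (by decide)])
    set r := (z / μ 0).re
    rw [div_eq_iff (hμ0 _)] at hj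
    have hm := hμ0 0
    have hz1 : (r : ℂ) - 1 ≠ 0 := fun h => hz 0 (by linear_combination hj + μ 0 * h)
    have hz2 : (r : ℂ) + 1 ≠ 0 := fun h => hz 1 (by rw [h3]; linear_combination hj + μ 0 * h)
    rw [Fin.sum_univ_two] at h1 h2 hsw
    have e1 : z - μ 0 = (r - 1) * μ 0 := by rw [hj]; ring
    have e2 : z - μ 1 = (r + 1) * μ 0 := by rw [h3, hj]; ring
    rw [e1, e2, h3] at h1 h2
    have h1' : ((r - 1) * (r + 1) + s * (w 0 * (r + 1) - w 1 * (r - 1)) : ℂ) = 0 := by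
      field_simp at h1
      linear_combination h1
    have h2' : (w 0 * (r + 1) ^ 2 - w 1 * (r - 1) ^ 2 : ℂ) = 0 := by
      field_simp at h2
      linear_combination h2
    have h1r : (r - 1) * (r + 1) + s * (w 0 * (r + 1) - w 1 * (r - 1)) = 0 := by exact_mod_cast h1'
    have h2r : w 0 * (r + 1) ^ 2 - w 1 * (r - 1) ^ 2 = 0 := by exact_mod_cast h2'
    have hz1r : r - 1 ≠ 0 := by exact_mod_cast hz1
    have hz2r : r + 1 ≠ 0 := by exact_mod_cast hz2
    -- The critical equation makes `s w 0` and `s w 1` proportional to `(r - 1)²` and `(r + 1)²`.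
    -- The value equation then forces `κ = 1/2`, so `s (w 0 + w 1) = r² + 1 ≥ 1`, contradicting
    -- `hsw`.
    obtain ⟨κ, hκ⟩ : ∃ κ, κ * (r - 1) ^ 2 = s * w 0 := ⟨s * w 0 / (r - 1) ^ 2, by field_simp⟩
    have hκ' : κ * (r + 1) ^ 2 = s * w 1 := by
      apply mul_right_cancel₀ (pow_ne_zero 2 hz1r)
      linear_combination (r + 1) ^ 2 * hκ + s * h2r
    have h4 : ((r - 1) * (r + 1)) * (1 - 2 * κ) = 0 := by
      linear_combination h1r + (r + 1) * hκ - (r - 1) * hκ'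
    have h5 := (mul_eq_zero.1 h4).resolve_left (mul_ne_zero hz1r hz2r)
    nlinarith [sq_nonneg r]
  | n + 3, μ, w =>
    have h3 := hreal ⟨0, by omega⟩ ⟨1, by omega⟩ (by simp)
    have h4 := hreal ⟨0, by omega⟩ ⟨2, by omega⟩ (by simp)
    simpa using hμ (h3.trans h4.symm)

end Secular

/-! ### Multiple eigenvalues form a null set -/

section Double

variable {N : ℕ} {μ : Fin N → ℂ}

lemma not_hasSimpleSpectrum_iff {A : Matrix (Fin N) (Fin N) ℂ} :
    ¬HasSimpleSpectrum A ↔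
      ∃ z, A.charpoly.eval z = 0 ∧ (derivative A.charpoly).eval z = 0 := by
  have h0 : A.charpoly ≠ 0 := A.charpoly_monic.ne_zero
  rw [HasSimpleSpectrum, Multiset.nodup_iff_count_le_one, not_forall]
  refine exists_congr fun z => ?_
  rw [not_le, count_roots, one_lt_rootMultiplicity_iff_isRoot h0]
  rfl

/-- At a node the pencil takes a nonzero value because the weights do not vanish. Away from the
nodes it factors as `P (1 + s f)` with `P ≠ 0`, so a double root means `1 + s f = 0` and `f' = 0`.
-/
lemma critical_of_double_root (hμ : Function.Injective μ) (hμ0 : ∀ k, μ k ≠ 0) {w : Fin N → ℝ}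
    (hw : ∀ k, w k ≠ 0) {s : ℝ} (hs : s ≠ 0) {z : ℂ}
    (h0 : (nodePoly μ + C (s : ℂ) * weightPoly μ w).eval z = 0)
    (h1 : (derivative (nodePoly μ + C (s : ℂ) * weightPoly μ w)).eval z = 0) :
    (∀ k, z ≠ μ k) ∧ 1 + (s : ℂ) * ∑ k, (w k : ℂ) * μ k / (z - μ k) = 0 ∧
      ∑ k, (w k : ℂ) * μ k / (z - μ k) ^ 2 = 0 := by
  have hs' : (s : ℂ) ≠ 0 := by exact_mod_cast hs
  have hz : ∀ k, z ≠ μ k := by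
    rintro k rfl
    rw [eval_add, eval_mul, eval_C, eval_weightPoly_node, eval_nodePoly,
      Finset.prod_eq_zero (Finset.mem_univ k) (sub_self _), zero_add] at h0
    exact mul_ne_zero hs' (mul_ne_zero (mul_ne_zero (by exact_mod_cast hw k) (hμ0 k))
      (Finset.prod_ne_zero_iff.2 fun l hl =>
        sub_ne_zero.2 (hμ.ne (Finset.ne_of_mem_erase hl).symm))) h0
  have hp : (nodePoly μ).eval z ≠ 0 := by
    rw [eval_nodePoly]
    exact Finset.prod_ne_zero_iff.2 fun k _ => sub_ne_zero.2 (hz k)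
  have hfac : ∀ x, (∀ k, x ≠ μ k) → (nodePoly μ + C (s : ℂ) * weightPoly μ w).eval x
      = (nodePoly μ).eval x * (1 + (s : ℂ) * ∑ k, (w k : ℂ) * μ k / (x - μ k)) := fun x hx => by
    rw [eval_add, eval_mul, eval_C, eval_weightPoly_of_ne _ hx]; ring
  have hcrit := h0
  rw [hfac z hz] at hcrit
  replace hcrit := (mul_eq_zero.1 hcrit).resolve_left hp
  refine ⟨hz, hcrit, ?_⟩
  have hev : ∀ᶠ x in 𝓝 z, ∀ k, x ≠ μ k :=
    eventually_all.2 fun k => isOpen_ne.mem_nhds (hz k)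
  have hder : HasDerivAt (fun x => ∑ k, (w k : ℂ) * μ k / (x - μ k))
      (∑ k, -((w k : ℂ) * μ k / (z - μ k) ^ 2)) z := by
    refine HasDerivAt.fun_sum fun k _ => ?_
    have h2 := (((hasDerivAt_id z).sub_const (μ k)).inv (sub_ne_zero.2 (hz k))).const_mul
      ((w k : ℂ) * μ k)
    refine (h2.congr_deriv ?_).congr_of_eventuallyEq (Eventually.of_forall fun x => ?_)
    · simp only [id]; ring
    · simp [div_eq_mul_inv]
  have hprod := ((nodePoly μ).hasDerivAt z).mul ((hder.const_mul (s : ℂ)).const_add 1)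
  have huniq := ((nodePoly μ + C (s : ℂ) * weightPoly μ w).hasDerivAt z).unique
    (hprod.congr_of_eventuallyEq (hev.mono fun x hx => hfac x hx))
  rw [h1, hcrit, mul_zero, zero_add, Finset.sum_neg_distrib] at huniq
  have h3 := (mul_eq_zero.1 huniq.symm).resolve_left hp
  exact neg_eq_zero.1 ((mul_eq_zero.1 h3).resolve_left hs')

end Double

/-! ### Measurability of the sets of matrices and vectors with multiple eigenvalues -/

section Measurability

variable {N : ℕ}

instance : SecondCountableTopology (Matrix (Fin N) (Fin N) ℂ) :=
  inferInstanceAs (SecondCountableTopology (Fin N → Fin N → ℂ))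

instance : LocallyCompactSpace (Matrix (Fin N) (Fin N) ℂ) :=
  inferInstanceAs (LocallyCompactSpace (Fin N → Fin N → ℂ))

instance : BorelSpace (Matrix (Fin N) (Fin N) ℂ) := ⟨rfl⟩

/-- A locally closed set here is locally compact and second countable, hence σ-compact, and so its
projection is a countable union of compact sets. This serves for sets defined by the existence of a
double root and a time. -/
lemma IsLocallyClosed.measurableSet_image_fst {X K : Type*} [TopologicalSpace X]
    [TopologicalSpace K] [SecondCountableTopology X] [SecondCountableTopology K]
    [LocallyCompactSpace X] [LocallyCompactSpace K] [T2Space X] [MeasurableSpace X]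
    [OpensMeasurableSpace X] {S : Set (X × K)} (hS : IsLocallyClosed S) :
    MeasurableSet (Prod.fst '' S) := by
  have := hS.locallyCompactSpace
  have hσ : IsSigmaCompact S := isSigmaCompact_iff_sigmaCompactSpace.2 inferInstance
  obtain ⟨T, hT, hTS⟩ := hσ.image continuous_fst
  rw [← hTS]
  exact MeasurableSet.iUnion fun n => (hT n).measurableSet

lemma continuous_charpoly_coeff (i : ℕ) :
    Continuous fun A : Matrix (Fin N) (Fin N) ℂ => A.charpoly.coeff i := by
  have h : ∀ A : Matrix (Fin N) (Fin N) ℂ, A.charpoly.coeff i =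
      MvPolynomial.eval (fun p : Fin N × Fin N => A p.1 p.2)
        ((Matrix.charpoly.univ ℂ (Fin N)).coeff i) := fun A =>
    (Matrix.charpoly.univ_coeff_eval₂Hom (Fin N) (RingHom.id ℂ) (fun p => A p.1 p.2) i).symm
  simp only [h]
  exact (MvPolynomial.continuous_eval _).comp
    (continuous_pi fun p => continuous_id.matrix_elem p.1 p.2)

variable {X : Type*} [TopologicalSpace X] {A : X → Matrix (Fin N) (Fin N) ℂ} {z : X → ℂ}

lemma Continuous.eval_charpoly (hA : Continuous A) (hz : Continuous z) :
    Continuous fun x => (A x).charpoly.eval (z x) := by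
  have h : ∀ x, (A x).charpoly.eval (z x)
      = ∑ i ∈ Finset.range (N + 1), (A x).charpoly.coeff i * z x ^ i := fun x =>
    eval_eq_sum_range' (by rw [Matrix.charpoly_natDegree_eq_dim, Fintype.card_fin]; omega) _
  simp only [h]
  exact continuous_finsetSum _ fun i _ =>
    ((continuous_charpoly_coeff i).comp hA).mul (hz.pow i)

lemma Continuous.eval_derivative_charpoly (hA : Continuous A) (hz : Continuous z) :
    Continuous fun x => (derivative (A x).charpoly).eval (z x) := by
  have h : ∀ x, (derivative (A x).charpoly).eval (z x)
      = ∑ i ∈ Finset.range (N + 1), ((A x).charpoly.coeff (i + 1) * (i + 1)) * z x ^ i := fun x => by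
    rw [eval_eq_sum_range' (n := N + 1)]
    · simp only [coeff_derivative]
    · refine (natDegree_derivative_le _).trans_lt ?_
      rw [Matrix.charpoly_natDegree_eq_dim, Fintype.card_fin]; omega
  simp only [h]
  exact continuous_finsetSum _ fun i _ =>
    (((continuous_charpoly_coeff (i + 1)).comp hA).mul continuous_const).mul (hz.pow i)

lemma isClosed_double_root (hA : Continuous A) (hz : Continuous z) :
    IsClosed {x | (A x).charpoly.eval (z x) = 0 ∧ (derivative (A x).charpoly).eval (z x) = 0} :=
  (isClosed_eq (hA.eval_charpoly hz) continuous_const).inter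
    (isClosed_eq (hA.eval_derivative_charpoly hz) continuous_const)

lemma measurableSet_hasSimpleSpectrum :
    MeasurableSet {A : Matrix (Fin N) (Fin N) ℂ | HasSimpleSpectrum A} := by
  rw [← MeasurableSet.compl_iff]
  convert! (isClosed_double_root (X := Matrix (Fin N) (Fin N) ℂ × ℂ) continuous_fst
    continuous_snd).isLocallyClosed.measurableSet_image_fst using 1
  ext A
  simp only [mem_compl_iff, mem_ofPred_eq, not_hasSimpleSpectrum_iff, mem_image, Prod.exists,
    exists_and_right, exists_eq_right]

lemma continuous_vecMulVec_star :
    Continuous fun y : EuclideanSpace ℂ (Fin N) =>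
      Matrix.vecMulVec (WithLp.ofLp y) (star (WithLp.ofLp y)) := by
  refine continuous_matrix fun i j => ?_
  simp only [Matrix.vecMulVec_apply, Pi.star_apply]
  fun_prop

/-- The pairs `(M, v)` for which two eigenvalues of `G(t)` collide at some `t ∈ (0, 1)`. -/
def collisionSet (N : ℕ) :
    Set (Matrix (Fin N) (Fin N) ℂ × Metric.sphere (0 : EuclideanSpace ℂ (Fin N)) 1) :=
  {p | ∃ t ∈ Ioo (0 : ℝ) 1, ¬HasSimpleSpectrum (perturbed p.1 p.2 t)}

lemma measurableSet_collisionSet : MeasurableSet (collisionSet N) := by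
  let Y := (Matrix (Fin N) (Fin N) ℂ × Metric.sphere (0 : EuclideanSpace ℂ (Fin N)) 1) × (ℝ × ℂ)
  have hA : Continuous fun x : Y => perturbed x.1.1 x.1.2 x.2.1 := by
    have h1 : Continuous fun x : Y => Matrix.vecMulVec
        (WithLp.ofLp (x.1.2 : EuclideanSpace ℂ (Fin N)))
        (star (WithLp.ofLp (x.1.2 : EuclideanSpace ℂ (Fin N)))) :=
      continuous_vecMulVec_star.comp
        (continuous_subtype_val.comp (continuous_snd.comp continuous_fst))
    have h2 : Continuous fun x : Y => 1 - ((x.2.1 : ℝ) : ℂ) :=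
      continuous_const.sub (Complex.continuous_ofReal.comp (continuous_fst.comp continuous_snd))
    exact (continuous_fst.comp continuous_fst).matrix_mul (continuous_const.sub (h2.smul h1))
  have hopen : IsOpen {x : Y | x.2.1 ∈ Ioo (0 : ℝ) 1} :=
    isOpen_Ioo.preimage (continuous_fst.comp continuous_snd)
  convert! (hopen.isLocallyClosed.inter (isClosed_double_root hA
    (continuous_snd.comp continuous_snd)).isLocallyClosed).measurableSet_image_fst using 1
  ext p
  simp only [collisionSet, mem_ofPred_eq, not_hasSimpleSpectrum_iff, mem_image, mem_inter_iff]
  constructor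
  · rintro ⟨t, ht, z, hz⟩
    exact ⟨(p, (t, z)), ⟨ht, hz⟩, rfl⟩
  · rintro ⟨⟨p', t, z⟩, ⟨ht, hz⟩, rfl⟩
    exact ⟨t, ht, z, hz⟩

end Measurability

/-! ### For a fixed unitary matrix, the colliding vectors form a null set -/

section Null

variable {N : ℕ} {U : Matrix (Fin N) (Fin N) ℂ} {μ : Fin N → ℂ}
  {u : OrthonormalBasis (Fin N) ℂ (EuclideanSpace ℂ (Fin N))}

/-- The vectors `y` with non-zero weights for which `U (1 - s y y^*)` has a multiple eigenvalue off
the line through `μ j`, for some `s` between `0` and `1 / ‖y‖ ^ 2`. -/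
def offLineCollisionSet (U : Matrix (Fin N) (Fin N) ℂ) (μ : Fin N → ℂ)
    (u : OrthonormalBasis (Fin N) ℂ (EuclideanSpace ℂ (Fin N))) (j : Fin N) :
    Set (EuclideanSpace ℂ (Fin N)) :=
  {y | ∃ (s : ℝ) (z : ℂ), (0 < s ∧ (∀ k, weight u y k ≠ 0) ∧ (z / μ j).im ≠ 0) ∧
    (U * (1 - (s : ℂ) • Matrix.vecMulVec (WithLp.ofLp y) (star (WithLp.ofLp y)))).charpoly.eval z
      = 0 ∧
    (derivative (U * (1 - (s : ℂ) • Matrix.vecMulVec (WithLp.ofLp y)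
      (star (WithLp.ofLp y)))).charpoly).eval z = 0}

lemma continuous_weight (k : Fin N) : Continuous fun y => weight u y k :=
  (continuous_const.inner continuous_id).norm.pow 2

lemma measurableSet_offLineCollisionSet (j : Fin N) :
    MeasurableSet (offLineCollisionSet U μ u j) := by
  let Y := EuclideanSpace ℂ (Fin N) × (ℝ × ℂ)
  have hA : Continuous fun x : Y =>
      U * (1 - (x.2.1 : ℂ) • Matrix.vecMulVec (WithLp.ofLp x.1) (star (WithLp.ofLp x.1))) :=
    continuous_const.matrix_mul (continuous_const.sub
      ((Complex.continuous_ofReal.comp (continuous_fst.comp continuous_snd)).smul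
        (continuous_vecMulVec_star.comp continuous_fst)))
  have hopen : IsOpen {x : Y | 0 < x.2.1 ∧ (∀ k, weight u x.1 k ≠ 0) ∧ (x.2.2 / μ j).im ≠ 0} := by
    refine (isOpen_lt continuous_const (continuous_fst.comp continuous_snd)).inter
      (IsOpen.inter ?_ ?_)
    · have hset : {x : Y | ∀ k, weight u x.1 k ≠ 0} = ⋂ k, {x : Y | weight u x.1 k ≠ 0} := by
        ext; simp
      change IsOpen {x : Y | ∀ k, weight u x.1 k ≠ 0}
      rw [hset]
      exact isOpen_iInter_of_finite fun k =>
        isOpen_ne_fun ((continuous_weight k).comp continuous_fst) continuous_const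
    · exact isOpen_ne_fun (Complex.continuous_im.comp
        ((continuous_snd.comp continuous_snd).div_const _)) continuous_const
  convert! (hopen.isLocallyClosed.inter (isClosed_double_root hA
    (continuous_snd.comp continuous_snd)).isLocallyClosed).measurableSet_image_fst using 1
  ext y
  simp only [offLineCollisionSet, mem_ofPred_eq, mem_image, mem_inter_iff]
  constructor
  · rintro ⟨s, z, h⟩
    exact ⟨(y, (s, z)), h, rfl⟩
  · rintro ⟨⟨y', s, z⟩, h, rfl⟩
    exact ⟨s, z, h⟩

lemma inner_add_smul_self (j : Fin N) (y : EuclideanSpace ℂ (Fin N)) (c : ℂ) :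
    inner ℂ (u j) (y + c • u j) = inner ℂ (u j) y + c := by
  rw [inner_add_right, inner_smul_right, inner_self_eq_norm_sq_to_K, u.norm_eq_one]
  simp

lemma inner_add_smul_of_ne {j k : Fin N} (hkj : k ≠ j) (y : EuclideanSpace ℂ (Fin N)) (c : ℂ) :
    inner ℂ (u k) (y + c • u j) = inner ℂ (u k) y := by
  rw [inner_add_right, inner_smul_right, u.inner_eq_zero hkj, mul_zero, add_zero]

lemma ae_weight_ne_zero (u : OrthonormalBasis (Fin N) ℂ (EuclideanSpace ℂ (Fin N))) (j : Fin N) :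
    ∀ᵐ y : EuclideanSpace ℂ (Fin N), weight u y j ≠ 0 := by
  refine ae_mem_of_ae_add_linearMap_mem (LinearMap.toSpanSingleton ℂ _ (u j))
    (volume : Measure ℂ) volume (s := {y | weight u y j ≠ 0})
    (isOpen_ne_fun (continuous_weight j) continuous_const).measurableSet fun y => ?_
  filter_upwards [compl_mem_ae_iff.2 (measure_singleton (μ := (volume : Measure ℂ))
    (-inner ℂ (u j) y))] with c hc h
  rw [weight, LinearMap.toSpanSingleton_apply, inner_add_smul_self, sq_eq_zero_iff,
    norm_eq_zero] at h
  exact hc (eq_neg_of_add_eq_zero_right h)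

lemma measure_norm_sq_mem_countable {S : Set ℝ} (hS : S.Countable) (d : ℂ) :
    (volume : Measure ℂ) {c | ‖d + c‖ ^ 2 ∈ S} = 0 := by
  have h : {c | ‖d + c‖ ^ 2 ∈ S} ⊆ ⋃ x ∈ S, Metric.sphere (-d) (Real.sqrt x) := fun c hc => by
    refine mem_biUnion hc ?_
    rw [mem_sphere_iff_norm, Real.sqrt_sq (norm_nonneg _)]
    congr 1; ring
  exact measure_mono_null h ((measure_biUnion_null_iff hS).2 fun x _ =>
    Measure.addHaar_sphere _ _ _)

/-- Fubini along the complex lines `y + ℂ u j`, on which only the `j`-th weight changes. Bad values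
of that weight are countable, so bad parameters `c` lie on countably many circles. -/
lemma ae_notMem_offLineCollisionSet (h : IsUnimodularEigenbasis U μ u) {j k₀ : Fin N}
    (hk₀ : k₀ ≠ j) :
    ∀ᵐ y : EuclideanSpace ℂ (Fin N), y ∉ offLineCollisionSet U μ u j := by
  have hμ0 : ∀ k, μ k ≠ 0 := fun k => norm_ne_zero_iff.1 (by rw [h.norm_eq_one]; norm_num)
  refine ae_mem_of_ae_add_linearMap_mem (LinearMap.toSpanSingleton ℂ _ (u j))
    (volume : Measure ℂ) volume (measurableSet_offLineCollisionSet j).compl fun y => ?_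
  -- The weight at `k₀` is constant on the line. If it vanishes, the line misses the set altogether;
  -- otherwise it provides the nonzero coefficient needed for countability.
  by_cases ha : weight u y k₀ = 0
  · refine Eventually.of_forall fun c => ?_
    rintro ⟨s, z, ⟨-, hw, -⟩, -⟩
    apply hw k₀
    rwa [weight, LinearMap.toSpanSingleton_apply, inner_add_smul_of_ne hk₀]
  have hcount := countable_critical_weights h.injective hμ0 j hk₀ ha
  filter_upwards [compl_mem_ae_iff.2 (measure_norm_sq_mem_countable hcount (inner ℂ (u j) y))]
    with c hc
  rintro ⟨s, z, ⟨hs, hw, him⟩, h0, h1⟩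
  rw [LinearMap.toSpanSingleton_apply] at hw h0 h1
  rw [charpoly_mul_one_sub_vecMulVec h] at h0 h1
  obtain ⟨hz, hval, hcrit⟩ := critical_of_double_root h.injective hμ0 hw hs.ne' h0 h1
  have hwj : weight u (y + c • u j) j = ‖inner ℂ (u j) y + c‖ ^ 2 := by
    rw [weight, inner_add_smul_self]
  have hwk : ∀ k ∈ Finset.univ.erase j, weight u (y + c • u j) k = weight u y k := fun k hk => by
    rw [weight, inner_add_smul_of_ne (Finset.ne_of_mem_erase hk), weight]
  have hsplit : ∀ n : ℕ, ∑ k, (weight u (y + c • u j) k : ℂ) * μ k / (z - μ k) ^ n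
      = ((‖inner ℂ (u j) y + c‖ ^ 2 : ℝ) : ℂ) * μ j / (z - μ j) ^ n +
        ∑ k ∈ Finset.univ.erase j, (weight u y k : ℂ) * μ k / (z - μ k) ^ n := fun n => by
    rw [← Finset.add_sum_erase _ _ (Finset.mem_univ j), hwj]
    congr 1
    exact Finset.sum_congr rfl fun k hk => by rw [hwk k hk]
  refine hc ⟨z, hz, him, ?_, ?_⟩
  · have h2 := hsplit 1
    simp only [pow_one] at h2
    rw [← h2]
    have hs' : (s : ℂ) ≠ 0 := by exact_mod_cast hs.ne'
    have h3 : ∑ k, (weight u (y + c • u j) k : ℂ) * μ k / (z - μ k) = ((-s⁻¹ : ℝ) : ℂ) := by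
      push_cast
      field_simp
      linear_combination hval
    rw [h3, Complex.ofReal_im]
  · rw [← hsplit 2]; exact hcrit

/-- For almost every `y`, the spectrum of `U (1 - s y y^*)` is simple whenever
`0 < s < 1 / ‖y‖ ^ 2`. -/
lemma ae_hasSimpleSpectrum (h : IsUnimodularEigenbasis U μ u) :
    ∀ᵐ y : EuclideanSpace ℂ (Fin N), ∀ s : ℝ, 0 < s → s * ‖y‖ ^ 2 < 1 →
      HasSimpleSpectrum
        (U * (1 - (s : ℂ) • Matrix.vecMulVec (WithLp.ofLp y) (star (WithLp.ofLp y)))) := by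
  have hμ0 : ∀ k, μ k ≠ 0 := fun k => norm_ne_zero_iff.1 (by rw [h.norm_eq_one]; norm_num)
  have h1 : ∀ᵐ y : EuclideanSpace ℂ (Fin N), ∀ k, weight u y k ≠ 0 :=
    ae_all_iff.2 fun k => ae_weight_ne_zero u k
  have h2 : ∀ᵐ y : EuclideanSpace ℂ (Fin N), ∀ j k, k ≠ j → y ∉ offLineCollisionSet U μ u j :=
    ae_all_iff.2 fun j => ae_all_iff.2 fun k => by
      by_cases hkj : k = j
      · simp [hkj]
      · filter_upwards [ae_notMem_offLineCollisionSet h hkj] with y hy _ using hy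
  filter_upwards [h1, h2] with y hw hoff s hs hsy
  by_contra hno
  obtain ⟨z, hz0, hz1⟩ := not_hasSimpleSpectrum_iff.1 hno
  have hz0' := hz0
  have hz1' := hz1
  rw [charpoly_mul_one_sub_vecMulVec h] at hz0' hz1'
  obtain ⟨hz, hval, hcrit⟩ := critical_of_double_root h.injective hμ0 hw hs.ne' hz0' hz1'
  have hsw : s * ∑ k, weight u y k < 1 := by rwa [sum_weight]
  -- At `z = 0` the secular sum is `-∑ w k`, so the root equation would read `s ‖y‖² = 1`.
  have hzne : z ≠ 0 := by
    rintro rfl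
    have h3 : ∑ k, (weight u y k : ℂ) * μ k / (0 - μ k) = ((-∑ k, weight u y k : ℝ) : ℂ) := by
      push_cast
      rw [← Finset.sum_neg_distrib]
      refine Finset.sum_congr rfl fun k _ => ?_
      have := hμ0 k
      rw [zero_sub]
      field_simp
    rw [h3] at hval
    have h4 : 1 + s * -∑ k, weight u y k = 0 := by exact_mod_cast hval
    linarith
  obtain ⟨j, k, hkj, him⟩ := exists_im_ne_zero_of_critical h.injective h.norm_eq_one
    (fun k => lt_of_le_of_ne (sq_nonneg _) (hw k).symm) hs hsw hzne hz hval hcrit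
  exact hoff j k hkj ⟨s, z, ⟨hs, hw, him⟩, hz0, hz1⟩

/-- The surface measure of a set is a multiple of the volume of the truncated cone over it. For `y =
r v` and `s = (1 - t) / r²` the matrix `s y y^*` is `(1 - t) v v^*`, and `s ‖y‖² = 1 - t < 1`. -/
lemma sphereMeasure_collision (h : IsUnimodularEigenbasis U μ u) :
    sphereMeasure N (Prod.mk U ⁻¹' collisionSet N) = 0 := by
  rw [sphereMeasure,
    Measure.toSphere_apply' _ (measurable_prodMk_left measurableSet_collisionSet)]
  refine mul_eq_zero.2 (Or.inr (measure_mono_null ?_ (ae_iff.1 (ae_hasSimpleSpectrum h))))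
  rintro _ ⟨r, hr, _, ⟨v, ⟨t, ht, hsimple⟩, rfl⟩, rfl⟩ hall
  apply hsimple
  have hv : ‖(v : EuclideanSpace ℂ (Fin N))‖ = 1 := by simp
  have hr0 := hr.1.ne'
  have h1 := hall ((1 - t) / r ^ 2) (div_pos (by linarith [ht.2]) (pow_pos hr.1 2)) (by
    simp only [norm_smul, hv, mul_one, Real.norm_eq_abs, sq_abs]
    rw [div_mul_cancel₀ _ (pow_ne_zero 2 hr0)]
    linarith [ht.1])
  rw [perturbed]
  convert! h1 using 3
  ext i j
  have : (r : ℂ) ≠ 0 := by exact_mod_cast hr0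
  simp [Matrix.vecMulVec_apply]
  field_simp

end Null

/-! ### From fixed to random matrices -/

lemma ae_notMem_collisionSet {N : ℕ} {Ω : Type*} [MeasurableSpace Ω] (P : Measure Ω)
    [IsProbabilityMeasure P] {U : Ω → Matrix (Fin N) (Fin N) ℂ}
    {v : Ω → Metric.sphere (0 : EuclideanSpace ℂ (Fin N)) 1} (hU : Measurable U)
    (hv : Measurable v) (hunit : ∀ ω, U ω ∈ Matrix.unitaryGroup (Fin N) ℂ)
    (hsimple : ∀ᵐ ω ∂P, HasSimpleSpectrum (U ω)) (hind : IndepFun U v P)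
    (hac : P.map v ≪ sphereMeasure N) :
    ∀ᵐ ω ∂P, (U ω, v ω) ∉ collisionSet N := by
  have hlaw := (indepFun_iff_map_prod_eq_prod_map_map hU.aemeasurable hv.aemeasurable).1 hind
  have : IsProbabilityMeasure (P.map v) := Measure.isProbabilityMeasure_map hv.aemeasurable
  have hclosed : IsClosed {M : Matrix (Fin N) (Fin N) ℂ | M * star M = 1} :=
    isClosed_eq (continuous_id.matrix_mul continuous_star) continuous_const
  have hgood : ∀ᵐ M ∂(P.map U), M * star M = 1 ∧ HasSimpleSpectrum M :=
    (ae_map_iff hU.aemeasurable (hclosed.measurableSet.inter measurableSet_hasSimpleSpectrum)).2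
      (hsimple.mono fun ω h => ⟨Matrix.mem_unitaryGroup_iff.1 (hunit ω), h⟩)
  -- By independence the joint law is a product, so it suffices that the section over almost every
  -- `M` is null; absolute continuity transfers this from the surface measure to the law of `v`.
  have hnull : (P.map fun ω => (U ω, v ω)) (collisionSet N) = 0 := by
    rw [hlaw, Measure.measure_prod_null measurableSet_collisionSet]
    filter_upwards [hgood] with M hM
    obtain ⟨μ, b, hb⟩ := exists_unimodularEigenbasis (Matrix.mem_unitaryGroup_iff.2 hM.1) hM.2
    exact hac (sphereMeasure_collision hb)
  rw [Measure.map_apply (hU.prodMk hv) measurableSet_collisionSet] at hnull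
  exact measure_eq_zero_iff_ae_notMem.1 hnull

theorem mainTheorem9 (N : ℕ) :
    -- every unitary `U` with simple spectrum and every unit vector `v`
    (∀ (U : Matrix (Fin N) (Fin N) ℂ), U ∈ Matrix.unitaryGroup (Fin N) ℂ → HasSimpleSpectrum U →
      ∀ (θ : Fin N → ℝ) (u : Fin N → EuclideanSpace ℂ (Fin N)), IsEigenData U θ u →
      ∀ v : EuclideanSpace ℂ (Fin N), ‖v‖ = 1 →
      ∀ lam : Fin N → ℝ → ℂ, IsEigenvalueFlow U v θ lam →
        HasInitialVelocity v θ u lam ∧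
        ∀ t ∈ Ioo (0 : ℝ) 1, (Function.Injective fun k => lam k t) →
          ∀ j, HasDerivAt (lam j) (velocity t (fun k => lam k t) j) t) ∧
    -- `U` random with almost surely simple spectrum, `v` independent of `U` with a density
    (∀ {Ω : Type*} [MeasurableSpace Ω] (P : Measure Ω) [IsProbabilityMeasure P]
      (U : Ω → Matrix (Fin N) (Fin N) ℂ)
      (v : Ω → Metric.sphere (0 : EuclideanSpace ℂ (Fin N)) 1),
      Measurable U → Measurable v →
      (∀ ω, U ω ∈ Matrix.unitaryGroup (Fin N) ℂ) →
      (∀ᵐ ω ∂P, HasSimpleSpectrum (U ω)) →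
      IndepFun U v P →
      P.map v ≪ sphereMeasure N →
      ∀ᵐ ω ∂P, ∀ (θ : Fin N → ℝ) (u : Fin N → EuclideanSpace ℂ (Fin N)),
        IsEigenData (U ω) θ u →
        ∃ lam : Fin N → ℝ → ℂ, IsEigenvalueFlow (U ω) (v ω) θ lam ∧
          (∀ lam' : Fin N → ℝ → ℂ, IsEigenvalueFlow (U ω) (v ω) θ lam' →
            ∀ j, EqOn (lam' j) (lam j) (Ioc 0 1)) ∧
          HasInitialVelocity (v ω : EuclideanSpace ℂ (Fin N)) θ u lam ∧
          ∀ t ∈ Ioo (0 : ℝ) 1, (Function.Injective fun k => lam k t) ∧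
            ∀ j, HasDerivAt (lam j) (velocity t (fun k => lam k t) j) t) := by
  refine ⟨fun U hU hs θ u h v hv lam hl => flow_hasDeriv hU hs h hv hl, ?_⟩
  intro Ω _ P _ U v hU hv hunit hsimple hind hac
  filter_upwards [hsimple, ae_notMem_collisionSet P hU hv hunit hsimple hind hac]
    with ω hs hno θ u h
  have hnorm : ‖(v ω : EuclideanSpace ℂ (Fin N))‖ = 1 := by simp
  have hall : ∀ t ∈ Ioc (0 : ℝ) 1, HasSimpleSpectrum (perturbed (U ω) (v ω) t) := by
    intro t ht
    rcases ht.2.lt_or_eq with h1 | rfl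
    · by_contra hc
      exact hno ⟨t, ⟨ht.1, h1⟩, hc⟩
    · rwa [perturbed_one]
  obtain ⟨lam, hl, huniq, hinj⟩ := exists_unique_flow h hall
  obtain ⟨hinit, hode⟩ := flow_hasDeriv (hunit ω) hs h hnorm hl
  exact ⟨lam, hl, huniq, hinit, fun t ht =>
    ⟨hinj t (Ioo_subset_Ioc_self ht), hode t ht (hinj t (Ioo_subset_Ioc_self ht))⟩⟩
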